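/- **Setting.** Let $X$ be a finite-dimensional real normed space and $T>0$. Let $\Psi_0:X\to[0,\infty)$ be subadditive, positively $1$-homogeneous, with $\Psi_0(v)>0$ for $v\ne0$. Let $\Psi:X\to[0,\infty)$ be convex with $\Psi(0)=0$, $\Psi(v)/\|v\|\to\infty$ as $\|v\|\to\infty$, and $\lim_{\varepsilon\downarrow0}\varepsilon^{-1}\Psi(\varepsilon v)=\Psi_0(v)$ for all $v$. Let $\mathcal E\in C^1([0,T]\times X)$, written $\mathcal E_t(u)$, be such that for some $C>0$ one has $\mathcal E_t(u)\ge -C$ and $|\partial_t\mathcal E_t(u)|\le C(1+\mathcal E_t(u)^+)$ for all $(t,u)$. Put $K^*=\{w\in X^*:\langle w,z\rangle\le\Psi_0(z)\ \forall z\in X\}$, $\Psi_{0*}(w)=\sup_{\Psi_0(v)\le1}\langle w,v\rangle$, $\Psi^*(w)=\sup_v(\langle w,v\rangle-\Psi(v))$, and $$\mathfrak p(v,w)=\inf_{\varepsilon>0}\big(\varepsilon^{-1}\Psi(\varepsilon v)+\varepsilon^{-1}\Psi^*(w)\big),\qquad \Delta_t(u_0,u_1)=\inf_\vartheta\int_{r_0}^{r_1}\mathfrak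 p\big(\dot\vartheta,-\mathrm D\mathcal E_t(\vartheta)\big)\,dr,$$ the second infimum being over absolutely continuous $\vartheta:[r_0,r_1]\to X$ with $\vartheta(r_0)=u_0$, $\vartheta(r_1)=u_1$. For $u\in \mathrm{BV}([0,T];X)$ (defined at every point) let $u(t_\pm)$ be the one-sided limits, with $u(0_-)=u(0)$ and $u(T_+)=u(T)$, let $J_u$ be the set of $t\in[0,T]$ with $u(t_-)\neq u(t)$ or $u(t)\ne u(t_+)$, let $\mathrm{Var}_{\Psi_0}(u;0,t)$ be the pointwise $\Psi_0$-variation, let $u'_{\rm co}$ be the diffuse part of the distributional derivative of $u$ and $\mu$ a diffuse measure dominating it. For $0<t\le T$ put $$\mathrm{pVar}(u;0,t)=\int_{(0,t)}\Psi_0\Big(\frac{du'_{\rm co}}{d\mu}\Big)d\mu+\Delta_0(u(0),u(0_+))+\Delta_t(u(t_-),u(t))+\sum_{s\in J_u\cap(0,t)}\big[\Delta_s(u(s_-),u(s))+\Delta_s(u(s),u(s_+))\big],$$ and $\mathrm{pVar}(u;0,0)=0$. * $u$ is *globally stable* if $\mathcal E_t(u(t))\le\mathcal E_t(z)+\Psi_0(z-u(t))$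 for all $t\in[0,T]$, $z\in X$; it satisfies the *energy balance* (E) if $\mathcal E_t(u(t))+\mathrm{Var}_{\Psi_0}(u;0,t)=\mathcal E_0(u(0))+\int_0^t\partial_t\mathcal E_s(u(s))\,ds$ for all $t\in[0,T]$. It is an *energetic solution* if it has both properties. * $u$ is a *BV solution* if $-\mathrm D\mathcal E_t(u(t))\in K^*$ for a.e. $t\in[0,T]\setminus J_u$ and the identity in (E) holds for all $t\in[0,T]$ with $\mathrm{pVar}$ in place of $\mathrm{Var}_{\Psi_0}$. * For $-\infty\le r_0<r_1\le+\infty$, an absolutely continuous $\vartheta:[r_0,r_1]\to X$ is an *optimal transition* at time $t$ from $a=\vartheta(r_0)$ to $b=\vartheta(r_1)$ if $\dot\vartheta\ne0$ a.e., $\Psi_{0*}(-\mathrm D\mathcal E_t(\vartheta(r)))\ge1$ for all $r\in[r_0,r_1]$, and $\mathcal E_t(a)-\mathcal E_t(b)=\Delta_t(a,b)=\int_{r_0}^{r_1}\mathfrak p(\dot\vartheta,-\mathrm D\mathcal E_t(\vartheta))\,dr$. It is of *sliding* type if $-\mathrm D\mathcal E_t(\vartheta(r))\in K^*$ for all $r\in[r_0,r_1]$,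 and of *energetic* type if $\mathcal E_t(b)-\mathcal E_t(a)=-\Psi_0(b-a)$. **Statement.** 1. Let $u$ be a BV solution. Then $u$ satisfies (E) if and only if, for every $t\in J_u$, every optimal transition at time $t$ from $u(t_-)$ to $u(t)$ and every one from $u(t)$ to $u(t_+)$ is of energetic type. Moreover, (E) holds as soon as, for every $t\in J_u$, every optimal transition from $u(t_-)$ to $u(t_+)$ is of energetic type; and the latter condition is equivalent to (E) if $u(t)\in\{u(t_-),u(t_+)\}$ for every $t\in J_u$. 2. A BV solution $u$ is an energetic solution if and only if it is globally stable. In that case, for every $t\in J_u$, all optimal transitions at time $t$ from $u(t_-)$ to $u(t)$, from $u(t)$ to $u(t_+)$, and from $u(t_-)$ to $u(t_+)$ are of energetic type. 3. An energetic solution $u$ is a BV solution if and only if, for every $t\in J_u$, there is an optimal transition of sliding type at time $t$ from $u(t_-)$ to $u(t_+)$ that passes through $u(t)$. -/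

import Mathlib

open Set Filter Topology MeasureTheory
open scoped ENNReal

noncomputable section

/-- The data of a rate-independent system on a finite-dimensional normed space `X` together with
its viscous regularization, and the standing assumptions on them:
* `T > 0` is the final time and `E t u` the energy, which is of class `C¹` on `[0,T] × X`;
* `Ψ₀` is the rate-independent dissipation (a non-degenerate gauge);
* `Ψ` is the superlinear viscous dissipation, with `Ψ_ε(v) = ε⁻¹ Ψ(ε v) → Ψ₀(v)` as `ε ↓ 0`.
The values of `E` at times outside `[0,T]` are irrelevant. -/
structure RISystem (X : Type*) [NormedAddCommGroup X] [NormedSpace ℝ X] where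
  T : ℝ
  E : ℝ → X → ℝ
  Ψ₀ : X → ℝ
  Ψ : X → ℝ
  T_pos : 0 < T
  Ψ₀_pos : ∀ v, v ≠ 0 → 0 < Ψ₀ v
  Ψ₀_add_le : ∀ v₁ v₂, Ψ₀ (v₁ + v₂) ≤ Ψ₀ v₁ + Ψ₀ v₂
  Ψ₀_smul : ∀ (c : ℝ) (v : X), 0 ≤ c → Ψ₀ (c • v) = c * Ψ₀ v
  Ψ_nonneg : ∀ v, 0 ≤ Ψ v
  Ψ_convex : ConvexOn ℝ univ Ψ
  Ψ_zero : Ψ 0 = 0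
  Ψ_superlinear : Tendsto (fun v => Ψ v / ‖v‖) (Bornology.cobounded X) atTop
  Ψ_rescale : ∀ v, Tendsto (fun ε : ℝ => ε⁻¹ * Ψ (ε • v)) (𝓝[>] 0) (𝓝 (Ψ₀ v))
  E_contDiff : ContDiffOn ℝ 1 (fun q : ℝ × X => E q.1 q.2) (Icc 0 T ×ˢ univ)
  E_bound : ∃ C : ℝ, 0 < C ∧ ∀ t ∈ Icc 0 T, ∀ u : X, -C ≤ E t u ∧
    |derivWithin (fun s => E s u) (Icc 0 T) t| ≤ C * (1 + max (E t u) 0)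

namespace RISystem

variable {X : Type*} [NormedAddCommGroup X] [NormedSpace ℝ X]

/-- The differential `D E_t(u)` with respect to the state. -/
def DE (S : RISystem X) (t : ℝ) (u : X) : X →L[ℝ] ℝ := fderiv ℝ (S.E t) u

/-- The partial time derivative `∂_t E_t(u)`, one-sided at `t = 0` and `t = T`. -/
def dtE (S : RISystem X) (t : ℝ) (u : X) : ℝ := derivWithin (fun s => S.E s u) (Icc 0 S.T) t

/-- The stable set `K* = ∂Ψ₀(0)`. -/
def Kstar (S : RISystem X) : Set (X →L[ℝ] ℝ) := {w | ∀ z, w z ≤ S.Ψ₀ z}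

/-- The support function of the unit ball `{v | Ψ₀ v ≤ 1}`. -/
def Ψ₀star (S : RISystem X) (w : X →L[ℝ] ℝ) : ℝ := ⨆ v : {v : X // S.Ψ₀ v ≤ 1}, w v

/-- The convex conjugate of `Ψ`, which is finite everywhere because `Ψ` is superlinear. -/
def Ψconj (S : RISystem X) (w : X →L[ℝ] ℝ) : ℝ := ⨆ v : X, (w v - S.Ψ v)

/-- The vanishing viscosity contact potential
`𝔭(v,w) = inf_{ε > 0} (ε⁻¹ Ψ(ε v) + ε⁻¹ Ψ*(w))`; all the terms are nonnegative. -/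
def p (S : RISystem X) (v : X) (w : X →L[ℝ] ℝ) : ℝ :=
  ⨅ ε : Ioi (0 : ℝ), ((ε : ℝ)⁻¹ * S.Ψ ((ε : ℝ) • v) + (ε : ℝ)⁻¹ * S.Ψconj w)

/-- The Finsler cost `Δ(t; u₀, u₁)`: the infimum of `∫ 𝔭(ϑ', -D E_t(ϑ)) dr` over the absolutely
continuous curves `ϑ` from `u₀` to `u₁`. -/
def cost (S : RISystem X) (t : ℝ) (u₀ u₁ : X) : ℝ≥0∞ :=
  ⨅ (r₀ : ℝ) (r₁ : ℝ) (ϑ : ℝ → X) (_ : r₀ < r₁ ∧ AbsolutelyContinuousOnInterval ϑ r₀ r₁ ∧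
      ϑ r₀ = u₀ ∧ ϑ r₁ = u₁),
    ∫⁻ r in Ioo r₀ r₁, ENNReal.ofReal (S.p (deriv ϑ r) (-S.DE t (ϑ r)))

/-- The pointwise `Ψ₀`-variation of `u` on `[a,b]`, a supremum over the subdivisions
`a = τ 0 ≤ τ 1 ≤ ⋯ ≤ τ M = b`. -/
def Var (S : RISystem X) (u : ℝ → X) (a b : ℝ) : ℝ≥0∞ :=
  ⨆ (M : ℕ) (τ : ℕ → ℝ) (_ : Monotone τ ∧ τ 0 = a ∧ τ M = b),
    ∑ m ∈ Finset.range M, ENNReal.ofReal (S.Ψ₀ (u (τ (m + 1)) - u (τ m)))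

/-- The extension of `u : [0,T] → X` to the real line by `u 0` on the left and `u T` on the
right. -/
def ext (S : RISystem X) (u : ℝ → X) : ℝ → X := fun t => u (max 0 (min t S.T))

/-- The left limit `u(t₋)`, with the convention `u(0₋) = u(0)`. -/
def left (S : RISystem X) (u : ℝ → X) (t : ℝ) : X := Function.leftLim (S.ext u) t

/-- The right limit `u(t₊)`, with the convention `u(T₊) = u(T)`. -/
def right (S : RISystem X) (u : ℝ → X) (t : ℝ) : X := Function.rightLim (S.ext u) t

/-- The pointwise jump set of `u`. -/
def jumpSet (S : RISystem X) (u : ℝ → X) : Set ℝ :=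
  {t | t ∈ Icc 0 S.T ∧ (S.left u t ≠ u t ∨ u t ≠ S.right u t)}

/-- `u ∈ BV([0,T];X)`, for functions defined at every point. -/
def IsBV (S : RISystem X) (u : ℝ → X) : Prop := BoundedVariationOn u (Icc 0 S.T)

theorem IsBV.ext {S : RISystem X} {u : ℝ → X} (hu : S.IsBV u) :
    BoundedVariationOn (S.ext u) univ := by
  refine ne_top_of_le_ne_top hu ?_
  refine eVariationOn.comp_le_of_monotoneOn u (fun t => max 0 (min t S.T)) ?_ ?_
  · intro a _ b _ hab
    exact max_le_max le_rfl (min_le_min hab le_rfl)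
  · intro t _
    exact ⟨le_max_left _ _, max_le S.T_pos.le (min_le_right _ _)⟩

variable [FiniteDimensional ℝ X]

/-- The diffuse part `u'_co` of the distributional derivative `u'` of `u`: the derivative,
a vector measure, restricted to the complement of the (countable) jump set. -/
def diffuse (S : RISystem X) {u : ℝ → X} (hu : S.IsBV u) : VectorMeasure ℝ X :=
  haveI := FiniteDimensional.complete ℝ X
  hu.ext.vectorMeasure.restrict (S.jumpSet u)ᶜ

/-- A diffuse reference measure that dominates `u'_co` and the Lebesgue measure on `(0,T)`. -/
def refMeasure (S : RISystem X) {u : ℝ → X} (hu : S.IsBV u) : Measure ℝ :=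
  volume.restrict (Ioo 0 S.T) + (S.diffuse hu).variation

theorem continuous_coord (i : Fin (Module.finrank ℝ X)) :
    Continuous ((Module.finBasis ℝ X).coord i : X →+ ℝ) :=
  ((Module.finBasis ℝ X).coord i).continuous_of_finiteDimensional

/-- The `i`-th coordinate of `u'_co` in a basis of `X`. -/
def diffuseCoord (S : RISystem X) {u : ℝ → X} (hu : S.IsBV u)
    (i : Fin (Module.finrank ℝ X)) : SignedMeasure ℝ :=
  (S.diffuse hu).mapRange ((Module.finBasis ℝ X).coord i : X →+ ℝ) (continuous_coord i)

/-- The Radon-Nikodym density `du'_co/dμ` with respect to the reference measure `μ`, computed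
coordinatewise. -/
def density (S : RISystem X) {u : ℝ → X} (hu : S.IsBV u) : ℝ → X := fun t =>
  ∑ i, (S.diffuseCoord hu i).rnDeriv (S.refMeasure hu) t • Module.finBasis ℝ X i

/-- `∫_a^b Ψ₀(du'_co/dμ) dμ`, which does not depend on the dominating measure `μ` because `Ψ₀` is
positively 1-homogeneous. -/
def diffuseVar (S : RISystem X) {u : ℝ → X} (hu : S.IsBV u) (a b : ℝ) : ℝ≥0∞ :=
  ∫⁻ t in Ioo a b, ENNReal.ofReal (S.Ψ₀ (S.density hu t)) ∂(S.refMeasure hu)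

/-- The jump variation of `u` on `[a,b]` induced by the Finsler cost. -/
def jumpVar (S : RISystem X) (u : ℝ → X) (a b : ℝ) : ℝ≥0∞ :=
  S.cost a (u a) (S.right u a) + S.cost b (S.left u b) (u b) +
    ∑' t : ↥(S.jumpSet u ∩ Ioo a b),
      (S.cost t (S.left u t) (u t) + S.cost t (u t) (S.right u t))

/-- The (pseudo-)total variation of `u` on `[a,b]` induced by `𝔭` and the energy; it vanishes on
degenerate intervals. -/
def pVar (S : RISystem X) {u : ℝ → X} (hu : S.IsBV u) (a b : ℝ) : ℝ≥0∞ :=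
  if a < b then S.diffuseVar hu a b + S.jumpVar u a b else 0

/-- The work of the external forces, `∫_0^t ∂_t E_s(u(s)) ds`. -/
def work (S : RISystem X) (u : ℝ → X) (t : ℝ) : ℝ := ∫ s in (0 : ℝ)..t, S.dtE s (u s)

/-- Global stability. -/
def GloballyStable (S : RISystem X) (u : ℝ → X) : Prop :=
  ∀ t ∈ Icc 0 S.T, ∀ z : X, S.E t (u t) ≤ S.E t z + S.Ψ₀ (z - u t)

/-- The classical energy balance, with the `Ψ₀`-variation of `u`. -/
def EnergyBalance (S : RISystem X) (u : ℝ → X) : Prop :=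
  ∀ t ∈ Icc 0 S.T, ((S.E t (u t) : ℝ) : EReal) + (S.Var u 0 t : EReal) =
    ((S.E 0 (u 0) + S.work u t : ℝ) : EReal)

/-- Local stability, almost everywhere outside the jump set. -/
def LocallyStable (S : RISystem X) (u : ℝ → X) : Prop :=
  ∀ᵐ t ∂(volume : Measure ℝ), t ∈ Icc 0 S.T \ S.jumpSet u → -S.DE t (u t) ∈ S.Kstar

/-- The energy balance with the variation induced by `𝔭` and the energy. -/
def PEnergyBalance (S : RISystem X) {u : ℝ → X} (hu : S.IsBV u) : Prop :=
  ∀ t ∈ Icc 0 S.T, ((S.E t (u t) : ℝ) : EReal) + (S.pVar hu 0 t : EReal) =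
    ((S.E 0 (u 0) + S.work u t : ℝ) : EReal)

/-- Energetic solutions. -/
def IsEnergeticSolution (S : RISystem X) (u : ℝ → X) : Prop :=
  S.IsBV u ∧ S.GloballyStable u ∧ S.EnergyBalance u

/-- BV solutions. -/
def IsBVSolution (S : RISystem X) (u : ℝ → X) : Prop :=
  ∃ hu : S.IsBV u, S.LocallyStable u ∧ S.PEnergyBalance hu

/-- `ϑ : [r₀,r₁] → X` is an optimal transition from `um` to `up` at time `t`. The interval may be
unbounded, whence the extended reals: absolute continuity then means absolute continuity on
bounded subintervals, integrability of the derivative, and convergence at infinity.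

Stability of the endpoints is not part of the definition. When `um` and `up` are one-sided limits
of a BV solution at an interior time it is automatic; the values `u(t)` at jump times, in
particular `u(0)` and `u(T)`, may be unstable. -/
structure IsOptimalTransition (S : RISystem X) (t : ℝ) (um up : X) (r₀ r₁ : EReal)
    (ϑ : EReal → X) : Prop where
  lt : r₀ < r₁
  continuousOn : ContinuousOn ϑ (Icc r₀ r₁)
  absCont : ∀ a b : ℝ, r₀ ≤ a → a ≤ b → (b : EReal) ≤ r₁ →
    AbsolutelyContinuousOnInterval (fun r : ℝ => ϑ r) a b
  integrable : ∫⁻ r in Real.toEReal ⁻¹' Ioo r₀ r₁, ‖deriv (fun r : ℝ => ϑ r) r‖ₑ ≠ ∞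
  start : ϑ r₀ = um
  finish : ϑ r₁ = up
  deriv_ne : ∀ᵐ r : ℝ, r₀ < (r : EReal) → (r : EReal) < r₁ →
    deriv (fun r : ℝ => ϑ r) r ≠ 0
  unstable : ∀ r ∈ Icc r₀ r₁, 1 ≤ S.Ψ₀star (-S.DE t (ϑ r))
  energy_eq : ((S.E t um - S.E t up : ℝ) : EReal) = (S.cost t um up : EReal)
  cost_eq : S.cost t um up = ∫⁻ r in Real.toEReal ⁻¹' Ioo r₀ r₁,
    ENNReal.ofReal (S.p (deriv (fun r : ℝ => ϑ r) r) (-S.DE t (ϑ r)))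

/-- A curve on `[r₀,r₁]` is of sliding type. -/
def IsSliding (S : RISystem X) (t : ℝ) (r₀ r₁ : EReal) (ϑ : EReal → X) : Prop :=
  ∀ r ∈ Icc r₀ r₁, -S.DE t (ϑ r) ∈ S.Kstar

/-- A transition from `um` to `up` is of energetic type; this only involves its endpoints. -/
def IsEnergeticType (S : RISystem X) (t : ℝ) (um up : X) : Prop :=
  S.E t up - S.E t um = -S.Ψ₀ (up - um)

/-- Every optimal transition from `um` to `up` at time `t` is of energetic type. -/
def TransitionsEnergetic (S : RISystem X) (t : ℝ) (um up : X) : Prop :=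
  ∀ (r₀ r₁ : EReal) (ϑ : EReal → X), S.IsOptimalTransition t um up r₀ r₁ ϑ →
    S.IsEnergeticType t um up

end RISystem

end

/-! The two notions of solution obey energy balances of the same shape. The pointwise variation of a
BV function is its diffuse variation plus the `Ψ₀`-sizes of its one-sided jumps
(`IsBV.Var_eq_jumpCostVar`); the pseudo-variation has the same diffuse part, but charges each
one-sided jump with its Finsler cost. Localizing either balance at a time `t` shows that the energy
released in each half of a jump equals the charge of that half (`JumpCostBalance.left`,
`JumpCostBalance.right`). Hence a BV solution satisfies (E) exactly when each half jump has a cost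
equal to its `Ψ₀`-size.

Since `𝔭(v,w)` dominates both `⟨w,v⟩` and `Ψ₀(v)`, the cost dominates both the released energy and
the `Ψ₀`-size of the increment. For a BV solution the half jumps release exactly their cost, and so
do the whole jumps, by the triangle inequality. Such a jump is of energetic type if and only if its
cost is its `Ψ₀`-size. A condition on all optimal transitions says this only if there is one, so the
analytic core is `exists_isOptimalTransition`. It comes from compactness of curves parametrized by
their cost. For a fixed value `m` of `Ψ*` the contact potential is sublinear in the velocity, so a
bound on the cost rate can be written through increments, without derivatives, and survives
pointwise limits. Lower semicontinuity of `Ψ*` then gives back the differential bound `𝔭 ≤ 1`.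

Global stability bounds the released energy by the `Ψ₀`-size, so that costs collapse to `Ψ₀`-sizes.
As `𝔭(v,w) > Ψ₀(v)` for `v ≠ 0` and `w ∉ K*`, the minimizing curves must then slide. Conversely, the
cost splits at each point of an optimal transition. If the transition passes through `u(t)`, the
costs of the two halves add up to at most the released energy, which by (E) is the sum of their
`Ψ₀`-sizes; equality follows term by term. -/

/-! ### Sublinear functions. -/

/-- **Hahn-Banach**: a finite sublinear function on a finite-dimensional space is attained at every
point by a continuous linear functional below it. -/
theorem exists_clm_le_sublinear_eq {X : Type*} [NormedAddCommGroup X] [NormedSpace ℝ X]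
    [FiniteDimensional ℝ X] {N : X → ℝ} (hsmul : ∀ (c : ℝ) (x : X), 0 ≤ c → N (c • x) = c * N x)
    (hadd : ∀ x y, N (x + y) ≤ N x + N y) (x : X) :
    ∃ g : X →L[ℝ] ℝ, g x = N x ∧ ∀ y, g y ≤ N y := by
  have h0 : N 0 = 0 := by simpa using hsmul 0 0 le_rfl
  have H : ∀ c : ℝ, c • x = 0 → (RingHom.id ℝ) c • N x = 0 := by
    intro c hc
    rcases smul_eq_zero.1 hc with rfl | rfl <;> simp [h0]
  obtain ⟨g, hgx, hg⟩ := exists_extension_of_le_sublinear (LinearPMap.mkSpanSingleton' x (N x) H) N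
    (fun c hc x => hsmul c x hc.le) hadd (by
      rintro ⟨y, hy⟩
      obtain ⟨c, rfl⟩ := Submodule.mem_span_singleton.1 hy
      rw [LinearPMap.mkSpanSingleton'_apply]
      simp only [RingHom.id_apply, smul_eq_mul]
      rcases le_total 0 c with hc | hc
      · rw [hsmul c x hc]
      · have h1 := hadd (c • x) ((-c) • x)
        rw [← add_smul, add_neg_cancel, zero_smul, h0, hsmul (-c) x (by linarith)] at h1
        linarith)
  refine ⟨LinearMap.toContinuousLinearMap g, ?_, fun y => by simpa using hg y⟩
  exact (hgx ⟨x, Submodule.mem_span_singleton_self x⟩).trans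
    (LinearPMap.mkSpanSingleton'_apply_self _ _ H _)

/-- A finite sublinear function on a finite-dimensional space is continuous. -/
theorem continuous_of_sublinear {X : Type*} [NormedAddCommGroup X] [NormedSpace ℝ X]
    [FiniteDimensional ℝ X] {N : X → ℝ} (hsmul : ∀ (c : ℝ) (x : X), 0 ≤ c → N (c • x) = c * N x)
    (hadd : ∀ x y, N (x + y) ≤ N x + N y) : Continuous N := by
  have : ConvexOn ℝ univ N := by
    refine ⟨convex_univ, fun x _ y _ a b ha hb _ => ?_⟩
    have := hadd (a • x) (b • y)
    rwa [hsmul a x ha, hsmul b y hb] at this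
  exact this.locallyLipschitz.continuous

/-! ### The contact potential and the conjugate of `Ψ`. -/

namespace RISystem

variable {X : Type*} [NormedAddCommGroup X] [NormedSpace ℝ X] (S : RISystem X)

theorem Ψ₀_zero : S.Ψ₀ 0 = 0 := by simpa using S.Ψ₀_smul 0 0 le_rfl

theorem Ψ₀_nonneg (v : X) : 0 ≤ S.Ψ₀ v := by
  rcases eq_or_ne v 0 with rfl | h
  · exact S.Ψ₀_zero.ge
  · exact (S.Ψ₀_pos v h).le

/-- By convexity and `Ψ 0 = 0`, difference quotients at the origin increase along rays. Their limit
`Ψ₀` is therefore a lower bound for all of them. -/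
theorem rescale_mono (v : X) {δ ε : ℝ} (hδ : 0 < δ) (h : δ ≤ ε) :
    δ⁻¹ * S.Ψ (δ • v) ≤ ε⁻¹ * S.Ψ (ε • v) := by
  have hε : 0 < ε := hδ.trans_le h
  have h1 := S.Ψ_convex.2 (mem_univ (ε • v)) (mem_univ (0 : X))
    (show 0 ≤ δ / ε by positivity) (show 0 ≤ 1 - δ / ε by rw [sub_nonneg, div_le_one hε]; exact h)
    (by ring)
  rw [smul_zero, add_zero, S.Ψ_zero, smul_smul, div_mul_cancel₀ _ hε.ne'] at h1
  simp only [smul_eq_mul, mul_zero, add_zero] at h1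
  calc δ⁻¹ * S.Ψ (δ • v) ≤ δ⁻¹ * (δ / ε * S.Ψ (ε • v)) := by gcongr
    _ = ε⁻¹ * S.Ψ (ε • v) := by field_simp

theorem Ψ₀_le_rescale (v : X) {ε : ℝ} (hε : 0 < ε) : S.Ψ₀ v ≤ ε⁻¹ * S.Ψ (ε • v) := by
  refine le_of_tendsto (S.Ψ_rescale v) ?_
  filter_upwards [Ioc_mem_nhdsGT hε] with δ hδ using S.rescale_mono v hδ.1 hδ.2

/-- The contact potential as a function of the velocity and of the value of `Ψ*`. -/
noncomputable def contact (v : X) (m : ℝ) : ℝ :=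
  ⨅ ε : Ioi (0 : ℝ), ((ε : ℝ)⁻¹ * S.Ψ ((ε : ℝ) • v) + (ε : ℝ)⁻¹ * m)

theorem contact_le {m : ℝ} (hm : 0 ≤ m) (v : X) {ε : ℝ} (hε : 0 < ε) :
    S.contact v m ≤ ε⁻¹ * S.Ψ (ε • v) + ε⁻¹ * m := by
  refine ciInf_le ⟨0, ?_⟩ (⟨ε, hε⟩ : Ioi (0 : ℝ))
  rintro _ ⟨⟨δ, hδ⟩, rfl⟩
  have := S.Ψ_nonneg (δ • v)
  have hδ' : 0 < δ := hδ
  positivity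

theorem le_contact {m a : ℝ} {v : X} (h : ∀ ε : ℝ, 0 < ε → a ≤ ε⁻¹ * S.Ψ (ε • v) + ε⁻¹ * m) :
    a ≤ S.contact v m :=
  le_ciInf fun ε => h ε ε.2

theorem Ψ₀_le_contact {m : ℝ} (hm : 0 ≤ m) (v : X) : S.Ψ₀ v ≤ S.contact v m :=
  S.le_contact fun ε hε => (S.Ψ₀_le_rescale v hε).trans (le_add_of_nonneg_right (by positivity))

theorem contact_nonneg {m : ℝ} (hm : 0 ≤ m) (v : X) : 0 ≤ S.contact v m :=
  (S.Ψ₀_nonneg v).trans (S.Ψ₀_le_contact hm v)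

theorem contact_mono {m m' : ℝ} (hm : 0 ≤ m) (h : m ≤ m') (v : X) :
    S.contact v m ≤ S.contact v m' :=
  S.le_contact fun ε hε => (S.contact_le hm v hε).trans (by gcongr)

theorem contact_zero_right (v : X) : S.contact v 0 = S.Ψ₀ v := by
  refine le_antisymm (ge_of_tendsto (S.Ψ_rescale v) ?_) (S.Ψ₀_le_contact le_rfl v)
  filter_upwards [self_mem_nhdsWithin] with ε hε
  simpa using S.contact_le le_rfl v hε

/-- Rescaling `ε` by `c` gives one inequality, and the same inequality for `c⁻¹` gives the other.
The case `c = 0` comes from `ε → ∞`. -/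
theorem contact_smul {m : ℝ} (hm : 0 ≤ m) (c : ℝ) (v : X) (hc : 0 ≤ c) :
    S.contact (c • v) m = c * S.contact v m := by
  have hzero : S.contact (0 : X) m = 0 := by
    refine le_antisymm ?_ (S.contact_nonneg hm 0)
    have h1 : Tendsto (fun ε : ℝ => ε⁻¹ * m) atTop (𝓝 0) := by
      simpa using tendsto_inv_atTop_zero.mul_const m
    refine ge_of_tendsto h1 ?_
    filter_upwards [eventually_gt_atTop 0] with ε hε
    simpa [S.Ψ_zero] using S.contact_le hm 0 hε
  have key : ∀ {c : ℝ} (v : X), 0 < c → c * S.contact v m ≤ S.contact (c • v) m := by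
    intro c v hc
    refine S.le_contact fun ε hε => ?_
    have := S.contact_le hm v (mul_pos hε hc)
    calc c * S.contact v m ≤ c * ((ε * c)⁻¹ * S.Ψ ((ε * c) • v) + (ε * c)⁻¹ * m) := by gcongr
      _ = _ := by rw [smul_smul]; field_simp
  rcases hc.eq_or_lt with rfl | hc
  · simp [hzero]
  · refine le_antisymm ?_ (key v hc)
    have := key (c • v) (inv_pos.2 hc)
    rw [smul_smul, inv_mul_cancel₀ hc.ne', one_smul] at this
    rwa [inv_mul_le_iff₀ hc] at this

theorem contact_zero_left {m : ℝ} (hm : 0 ≤ m) : S.contact (0 : X) m = 0 := by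
  simpa using S.contact_smul hm 0 0 le_rfl

/-- Competitors `δ` for `v` and `ε` for `w` combine, by convexity of `Ψ`, into a competitor for `v +
w`. -/
theorem contact_add_le {m : ℝ} (hm : 0 ≤ m) (v w : X) :
    S.contact (v + w) m ≤ S.contact v m + S.contact w m := by
  rw [← sub_le_iff_le_add']
  refine S.le_contact fun ε hε => ?_
  rw [sub_le_iff_le_add, ← sub_le_iff_le_add']
  refine S.le_contact fun δ hδ => ?_
  rw [sub_le_iff_le_add']
  have hs : 0 < ε + δ := add_pos hε hδ
  -- The reciprocal of this parameter is `ε⁻¹ + δ⁻¹`, so the terms in `m` add up exactly.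
  have h1 := S.contact_le hm (v + w) (ε := ε * δ / (ε + δ)) (by positivity)
  have h2 := S.Ψ_convex.2 (mem_univ (δ • v)) (mem_univ (ε • w))
    (show 0 ≤ ε / (ε + δ) by positivity) (show 0 ≤ δ / (ε + δ) by positivity)
    (by field_simp)
  have h3 : (ε / (ε + δ)) • δ • v + (δ / (ε + δ)) • ε • w = (ε * δ / (ε + δ)) • (v + w) := by
    rw [smul_smul, smul_smul, smul_add]
    congr 2 <;> ring
  rw [h3] at h2
  simp only [smul_eq_mul] at h2
  calc S.contact (v + w) m ≤ _ := h1
    _ ≤ (ε * δ / (ε + δ))⁻¹ * (ε / (ε + δ) * S.Ψ (δ • v) + δ / (ε + δ) * S.Ψ (ε • w))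
        + (ε * δ / (ε + δ))⁻¹ * m := by gcongr
    _ = _ := by field_simp; ring

/-- This serves as continuity from below in `m`: a bound for all `θ * m` with `θ < 1` extends to
`m`. -/
theorem mul_contact_le {m θ : ℝ} (hm : 0 ≤ m) (hθ : 0 ≤ θ) (hθ1 : θ ≤ 1) (v : X) :
    θ * S.contact v m ≤ S.contact v (θ * m) := by
  refine S.le_contact fun ε hε => ?_
  have h1 := S.contact_le hm v hε
  have h2 : 0 ≤ ε⁻¹ * S.Ψ (ε • v) := mul_nonneg (by positivity) (S.Ψ_nonneg _)
  calc θ * S.contact v m ≤ θ * (ε⁻¹ * S.Ψ (ε • v) + ε⁻¹ * m) := by gcongr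
    _ = θ * (ε⁻¹ * S.Ψ (ε • v)) + ε⁻¹ * (θ * m) := by ring
    _ ≤ _ := add_le_add_left (mul_le_of_le_one_left h2 hθ1) _

/-- Superlinearity: `Ψ` dominates every multiple of the norm outside a ball. -/
theorem exists_mul_norm_le (A : ℝ) : ∃ R : ℝ, 0 < R ∧ ∀ v : X, R ≤ ‖v‖ → A * ‖v‖ ≤ S.Ψ v := by
  have h := S.Ψ_superlinear.eventually (eventually_ge_atTop A)
  rw [← comap_norm_atTop, eventually_comap] at h
  obtain ⟨R, hR⟩ := eventually_atTop.1 h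
  refine ⟨max R 1, by positivity, fun v hv => ?_⟩
  have h1 := hR ‖v‖ ((le_max_left _ _).trans hv) v rfl
  have h2 : 0 < ‖v‖ := lt_of_lt_of_le (by positivity) hv
  rwa [le_div_iff₀ h2] at h1

/-- Outside contact the potential is strictly larger than the rate-independent dissipation. -/
theorem eq_zero_of_contact_le {m : ℝ} (hm : 0 ≤ m) {v : X} (hv : v ≠ 0)
    (h : S.contact v m ≤ S.Ψ₀ v) : m = 0 := by
  by_contra hne
  have hm0 : 0 < m := lt_of_le_of_ne hm (Ne.symm hne)
  have hv0 : 0 < ‖v‖ := norm_pos_iff.2 hv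
  obtain ⟨R, hR, hRv⟩ := S.exists_mul_norm_le ((S.Ψ₀ v + 1) / ‖v‖)
  -- For `ε ≥ R / ‖v‖` superlinearity yields a gain of `1` in the term with `Ψ`. For smaller `ε` the
  -- term with `m` yields a gain of at least `(R / ‖v‖)⁻¹ * m`.
  have key : S.Ψ₀ v + min 1 ((R / ‖v‖)⁻¹ * m) ≤ S.contact v m := by
    refine S.le_contact fun ε hε => ?_
    rcases le_total (R / ‖v‖) ε with h1 | h1
    · have h2 := hRv (ε • v) (by
        rw [norm_smul, Real.norm_of_nonneg hε.le]; rwa [div_le_iff₀ hv0] at h1)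
      rw [norm_smul, Real.norm_of_nonneg hε.le] at h2
      have h3 : S.Ψ₀ v + 1 ≤ ε⁻¹ * S.Ψ (ε • v) := by
        rw [le_inv_mul_iff₀ hε]
        calc ε * (S.Ψ₀ v + 1) = (S.Ψ₀ v + 1) / ‖v‖ * (ε * ‖v‖) := by field_simp
          _ ≤ _ := h2
      have h4 : 0 ≤ ε⁻¹ * m := by positivity
      linarith [min_le_left 1 ((R / ‖v‖)⁻¹ * m)]
    · have h2 := S.Ψ₀_le_rescale v hε
      have h3 : (R / ‖v‖)⁻¹ * m ≤ ε⁻¹ * m := by gcongr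
      linarith [min_le_right 1 ((R / ‖v‖)⁻¹ * m)]
  have : 0 < min 1 ((R / ‖v‖)⁻¹ * m) := lt_min one_pos (by positivity)
  linarith

/-- An unbounded real supremum would take the default value `0`. Growth of `Ψ` faster than `‖w‖ *
‖v‖` outside a ball excludes this. -/
theorem bddAbove_Ψconj (w : X →L[ℝ] ℝ) : BddAbove (range fun v : X => w v - S.Ψ v) := by
  obtain ⟨R, hR, hRv⟩ := S.exists_mul_norm_le ‖w‖
  refine ⟨‖w‖ * R, ?_⟩
  rintro _ ⟨v, rfl⟩
  have h1 : w v ≤ ‖w‖ * ‖v‖ := (le_abs_self _).trans (w.le_opNorm v)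
  rcases le_total R ‖v‖ with h | h
  · have := hRv v h
    have : 0 ≤ ‖w‖ * R := by positivity
    simp only
    linarith
  · have h2 : ‖w‖ * ‖v‖ ≤ ‖w‖ * R := by gcongr
    have := S.Ψ_nonneg v
    simp only
    linarith

theorem young (w : X →L[ℝ] ℝ) (v : X) : w v ≤ S.Ψ v + S.Ψconj w := by
  have := le_ciSup (S.bddAbove_Ψconj w) v
  simp only [Ψconj] at this ⊢
  linarith

theorem Ψconj_nonneg (w : X →L[ℝ] ℝ) : 0 ≤ S.Ψconj w := by
  simpa [S.Ψ_zero] using S.young w 0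

theorem p_eq_contact (v : X) (w : X →L[ℝ] ℝ) : S.p v w = S.contact v (S.Ψconj w) := rfl

theorem Ψ₀_le_p (v : X) (w : X →L[ℝ] ℝ) : S.Ψ₀ v ≤ S.p v w :=
  S.Ψ₀_le_contact (S.Ψconj_nonneg w) v

/-- Young's inequality at `ε • v`, divided by `ε`. Through the chain rule it makes the cost dominate
the released energy. -/
theorem apply_le_p (v : X) (w : X →L[ℝ] ℝ) : w v ≤ S.p v w := by
  refine S.le_contact fun ε hε => ?_
  have := S.young w (ε • v)
  rw [map_smul, smul_eq_mul] at this
  rwa [← mul_add, le_inv_mul_iff₀ hε]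

/-- If `w ≤ Ψ₀`, then `w ≤ Ψ` because `Ψ₀ ≤ Ψ`. If `Ψ*(w) = 0`, the contact potential reduces to
`Ψ₀` and still dominates `w`. -/
theorem mem_Kstar_iff_Ψconj (w : X →L[ℝ] ℝ) : w ∈ S.Kstar ↔ S.Ψconj w = 0 := by
  constructor
  · intro h
    refine le_antisymm (ciSup_le fun v => ?_) (S.Ψconj_nonneg w)
    have h1 := h v
    have h2 := S.Ψ₀_le_rescale v one_pos
    rw [inv_one, one_smul, one_mul] at h2
    linarith
  · intro h v
    rw [← S.contact_zero_right v, ← h]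
    exact S.apply_le_p v w

theorem lowerSemicontinuous_Ψconj : LowerSemicontinuous S.Ψconj := by
  intro w y hy
  obtain ⟨v, hv⟩ := exists_lt_of_lt_ciSup hy
  have hc : Continuous fun w' : X →L[ℝ] ℝ => w' v - S.Ψ v := by fun_prop
  filter_upwards [hc.continuousAt.eventually (lt_mem_nhds hv)] with w' hw'
  exact lt_of_lt_of_le hw' (le_ciSup (S.bddAbove_Ψconj w') v)

theorem isClosed_Kstar : IsClosed S.Kstar := by
  have : S.Kstar = ⋂ z, {w : X →L[ℝ] ℝ | w z ≤ S.Ψ₀ z} := by ext; simp [Kstar]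
  rw [this]
  exact isClosed_iInter fun z => isClosed_le (by fun_prop) continuous_const

variable [FiniteDimensional ℝ X]

theorem continuous_Ψ₀ : Continuous S.Ψ₀ := continuous_of_sublinear S.Ψ₀_smul S.Ψ₀_add_le

theorem continuous_contact {m : ℝ} (hm : 0 ≤ m) : Continuous fun v => S.contact v m :=
  continuous_of_sublinear (S.contact_smul hm) (S.contact_add_le hm)

theorem exists_norm_le_Ψ₀ : ∃ c : NNReal, 0 < c ∧ ∀ v : X, ‖v‖ ≤ c * S.Ψ₀ v := by
  rcases subsingleton_or_nontrivial X with h | h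
  · exact ⟨1, one_pos, fun v => by simp [Subsingleton.elim v 0, S.Ψ₀_zero]⟩
  · obtain ⟨x, hx, hmin⟩ := (isCompact_sphere (0 : X) 1).exists_isMinOn
      (NormedSpace.sphere_nonempty.2 zero_le_one) S.continuous_Ψ₀.continuousOn
    have hx0 : x ≠ 0 := by rintro rfl; simp at hx
    have hpos := S.Ψ₀_pos x hx0
    refine ⟨⟨(S.Ψ₀ x)⁻¹, by positivity⟩, NNReal.coe_pos.1 (inv_pos.2 hpos), fun v => ?_⟩
    rcases eq_or_ne v 0 with rfl | hv
    · simp [S.Ψ₀_zero]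
    · have hv0 : 0 < ‖v‖ := norm_pos_iff.2 hv
      have h1 : S.Ψ₀ x ≤ S.Ψ₀ (‖v‖⁻¹ • v) := hmin (by simp [norm_smul, hv0.ne'])
      rw [S.Ψ₀_smul _ _ (by positivity), le_inv_mul_iff₀ hv0] at h1
      change ‖v‖ ≤ (S.Ψ₀ x)⁻¹ * S.Ψ₀ v
      rw [le_inv_mul_iff₀ hpos]
      linarith

theorem exists_Ψ₀_le_norm : ∃ C : NNReal, ∀ v : X, S.Ψ₀ v ≤ C * ‖v‖ := by
  rcases subsingleton_or_nontrivial X with h | h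
  · exact ⟨1, fun v => by simp [Subsingleton.elim v 0, S.Ψ₀_zero]⟩
  · obtain ⟨x, hx, hmax⟩ := (isCompact_sphere (0 : X) 1).exists_isMaxOn
      (NormedSpace.sphere_nonempty.2 zero_le_one) S.continuous_Ψ₀.continuousOn
    refine ⟨⟨S.Ψ₀ x, S.Ψ₀_nonneg x⟩, fun v => ?_⟩
    rcases eq_or_ne v 0 with rfl | hv
    · simp [S.Ψ₀_zero]
    · have hv0 : 0 < ‖v‖ := norm_pos_iff.2 hv
      have h1 : S.Ψ₀ (‖v‖⁻¹ • v) ≤ S.Ψ₀ x := hmax (by simp [norm_smul, hv0.ne'])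
      rw [S.Ψ₀_smul _ _ (by positivity), inv_mul_le_iff₀ hv0] at h1
      change S.Ψ₀ v ≤ S.Ψ₀ x * ‖v‖
      linarith

theorem bddAbove_Ψ₀star (w : X →L[ℝ] ℝ) :
    BddAbove (range fun v : {v : X // S.Ψ₀ v ≤ 1} => w v) := by
  obtain ⟨c, hc, h⟩ := S.exists_norm_le_Ψ₀
  refine ⟨‖w‖ * c, ?_⟩
  rintro _ ⟨⟨v, hv⟩, rfl⟩
  calc w v ≤ ‖w‖ * ‖v‖ := (le_abs_self _).trans (w.le_opNorm v)
    _ ≤ ‖w‖ * c := by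
      gcongr
      exact (h v).trans (mul_le_of_le_one_right c.2 hv)

theorem le_Ψ₀star (w : X →L[ℝ] ℝ) {v : X} (hv : S.Ψ₀ v ≤ 1) : w v ≤ S.Ψ₀star w :=
  le_ciSup (S.bddAbove_Ψ₀star w) (⟨v, hv⟩ : {v : X // S.Ψ₀ v ≤ 1})

theorem continuous_Ψ₀star : Continuous S.Ψ₀star := by
  obtain ⟨c, hc, h⟩ := S.exists_norm_le_Ψ₀
  have key : ∀ w w' : X →L[ℝ] ℝ, S.Ψ₀star w ≤ S.Ψ₀star w' + c * dist w w' := by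
    intro w w'
    have : Nonempty {v : X // S.Ψ₀ v ≤ 1} := ⟨⟨0, by simp [S.Ψ₀_zero]⟩⟩
    refine ciSup_le fun v => ?_
    have h1 := S.le_Ψ₀star w' v.2
    have h2 : (w - w') v ≤ ‖w - w'‖ * c := by
      calc (w - w') v ≤ ‖w - w'‖ * ‖(v : X)‖ := (le_abs_self _).trans ((w - w').le_opNorm v)
        _ ≤ ‖w - w'‖ * c := by
          gcongr
          exact (h v).trans (mul_le_of_le_one_right c.2 v.2)
    rw [dist_eq_norm]
    simp only [sub_apply] at h2
    linarith
  exact (LipschitzWith.of_le_add_mul c key).continuous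

end RISystem

/-! ### Absolutely continuous curves: chain rule and Jensen's inequality. -/

section AbsolutelyContinuous

variable {X : Type*} [NormedAddCommGroup X] [NormedSpace ℝ X]

theorem AbsolutelyContinuousOnInterval.lipschitzOnWith_comp {Y Z : Type*} [PseudoMetricSpace Y]
    [PseudoMetricSpace Z] {f : ℝ → Y} {a b : ℝ} (hf : AbsolutelyContinuousOnInterval f a b)
    {g : Y → Z} {K : NNReal} {s : Set Y} (hg : LipschitzOnWith K g s)
    (hs : ∀ r ∈ uIcc a b, f r ∈ s) :
    AbsolutelyContinuousOnInterval (fun r => g (f r)) a b := by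
  have h : Tendsto (fun E : ℕ × (ℕ → ℝ × ℝ) =>
      K * ∑ i ∈ Finset.range E.1, dist (f (E.2 i).1) (f (E.2 i).2))
      (AbsolutelyContinuousOnInterval.totalLengthFilter ⊓
        𝓟 (AbsolutelyContinuousOnInterval.disjWithin a b)) (𝓝 0) := by
    simpa using Tendsto.const_mul (K : ℝ) hf
  refine squeeze_zero' (Eventually.of_forall fun E => Finset.sum_nonneg fun i _ => dist_nonneg)
    ?_ h
  rw [eventually_inf_principal]
  refine Eventually.of_forall fun E hE => ?_
  rw [Finset.mul_sum]
  exact Finset.sum_le_sum fun i hi =>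
    hg.dist_le_mul _ (hs _ (hE.1 i hi).1) _ (hs _ (hE.1 i hi).2)

theorem ofReal_integral_le_lintegral_ofReal {α : Type*} [MeasurableSpace α] {μ : Measure α}
    {f : α → ℝ} (hf : Integrable f μ) :
    ENNReal.ofReal (∫ x, f x ∂μ) ≤ ∫⁻ x, ENNReal.ofReal (f x) ∂μ := by
  rw [integral_eq_lintegral_pos_part_sub_lintegral_neg_part hf]
  refine (ENNReal.ofReal_le_ofReal (sub_le_self _ ENNReal.toReal_nonneg)).trans ?_
  exact ENNReal.ofReal_toReal_le

variable [FiniteDimensional ℝ X] {F : X → ℝ} {f : ℝ → X} {a b : ℝ}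

/-- **Chain rule** along an absolutely continuous curve. -/
theorem AbsolutelyContinuousOnInterval.integral_fderiv_apply_deriv
    (hf : AbsolutelyContinuousOnInterval f a b) (hF : ContDiff ℝ 1 F) :
    IntervalIntegrable (fun r => fderiv ℝ F (f r) (deriv f r)) volume a b ∧
      ∫ r in a..b, fderiv ℝ F (f r) (deriv f r) = F (f b) - F (f a) := by
  obtain ⟨C, hC⟩ := hf.exists_bound
  obtain ⟨K, hK⟩ := hF.contDiffOn.exists_lipschitzOnWith one_ne_zero
    (convex_closedBall (0 : X) C) (isCompact_closedBall 0 C)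
  have hcomp : AbsolutelyContinuousOnInterval (fun r => F (f r)) a b :=
    hf.lipschitzOnWith_comp hK fun r hr => by simpa using hC r hr
  have hderiv : ∀ᵐ r, r ∈ uIoc a b →
      deriv (fun r => F (f r)) r = fderiv ℝ F (f r) (deriv f r) := by
    filter_upwards [hf.boundedVariationOn.ae_differentiableAt_of_mem_uIcc] with r hr hmem
    have h1 := (hr (uIoc_subset_uIcc hmem)).hasDerivAt
    exact (((hF.differentiable one_ne_zero) (f r)).hasFDerivAt.comp_hasDerivAt r h1).deriv
  refine ⟨hcomp.intervalIntegrable_deriv.congr_ae ?_, ?_⟩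
  · exact (ae_restrict_iff' measurableSet_uIoc).2 hderiv
  · rw [← hcomp.integral_deriv_eq_sub]
    exact (intervalIntegral.integral_congr_ae hderiv).symm

/-- The bound is stated with a lower integral, so that `h` may be any pointwise majorant, without
measurability or integrability. -/
theorem AbsolutelyContinuousOnInterval.ofReal_sub_le_lintegral
    (hf : AbsolutelyContinuousOnInterval f a b) (hab : a ≤ b) (hF : ContDiff ℝ 1 F) {h : ℝ → ℝ}
    (hh : ∀ r ∈ Ioo a b, fderiv ℝ F (f r) (deriv f r) ≤ h r) :
    ENNReal.ofReal (F (f b) - F (f a)) ≤ ∫⁻ r in Ioo a b, ENNReal.ofReal (h r) := by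
  obtain ⟨h1, h2⟩ := hf.integral_fderiv_apply_deriv hF
  rw [← h2, intervalIntegral.integral_of_le hab, integral_Ioc_eq_integral_Ioo]
  refine (ofReal_integral_le_lintegral_ofReal
    ((intervalIntegrable_iff_integrableOn_Ioo_of_le hab).1 h1)).trans ?_
  exact setLIntegral_mono' measurableSet_Ioo fun r hr => ENNReal.ofReal_le_ofReal (hh r hr)

/-- **Jensen's inequality** for sublinear functions of the velocity. -/
theorem AbsolutelyContinuousOnInterval.ofReal_sublinear_le_lintegral
    (hf : AbsolutelyContinuousOnInterval f a b) (hab : a ≤ b) {N : X → ℝ}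
    (hsmul : ∀ (c : ℝ) (x : X), 0 ≤ c → N (c • x) = c * N x)
    (hadd : ∀ x y, N (x + y) ≤ N x + N y) {h : ℝ → ℝ}
    (hh : ∀ r ∈ Ioo a b, N (deriv f r) ≤ h r) :
    ENNReal.ofReal (N (f b - f a)) ≤ ∫⁻ r in Ioo a b, ENNReal.ofReal (h r) := by
  -- A linear functional below `N` that touches it at the increment reduces Jensen's inequality to
  -- the chain rule.
  obtain ⟨g, hg, hgN⟩ := exists_clm_le_sublinear_eq hsmul hadd (f b - f a)
  rw [← hg, map_sub]
  refine hf.ofReal_sub_le_lintegral hab g.contDiff fun r hr => ?_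
  rw [g.fderiv]
  exact (hgN _).trans (hh r hr)

end AbsolutelyContinuous

/-! ### Regularity of the energy and lower bounds for the cost. -/

namespace RISystem

variable {X : Type*} [NormedAddCommGroup X] [NormedSpace ℝ X] (S : RISystem X)

theorem continuousOn_E : ContinuousOn (fun q : ℝ × X => S.E q.1 q.2) (Icc 0 S.T ×ˢ univ) :=
  S.E_contDiff.continuousOn

variable {S} in
theorem contDiff_E {t : ℝ} (ht : t ∈ Icc 0 S.T) : ContDiff ℝ 1 (S.E t) := by
  rw [← contDiffOn_univ]
  exact S.E_contDiff.comp (f := fun u : X => (t, u)) (by fun_prop) fun u _ => ⟨ht, mem_univ _⟩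

variable {S} in
theorem continuous_DE {t : ℝ} (ht : t ∈ Icc 0 S.T) : Continuous (S.DE t) :=
  (contDiff_E ht).continuous_fderiv one_ne_zero

theorem continuousOn_dtE : ContinuousOn (fun q : ℝ × X => S.dtE q.1 q.2) (Icc 0 S.T ×ˢ univ) := by
  have hu := uniqueDiffOn_Icc S.T_pos
  have h1 := S.E_contDiff.continuousOn_fderivWithin (hu.prod uniqueDiffOn_univ) le_rfl
  have h2 : ContinuousOn (fun q : ℝ × X => fderivWithin ℝ (fun q : ℝ × X => S.E q.1 q.2)
      (Icc 0 S.T ×ˢ univ) q ((1 : ℝ), (0 : X))) (Icc 0 S.T ×ˢ univ) :=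
    h1.clm_apply continuousOn_const
  refine h2.congr fun q hq => ?_
  have h3 := (S.E_contDiff.differentiableOn one_ne_zero q hq).hasFDerivWithinAt
  have h4 : HasDerivWithinAt (fun s : ℝ => (s, q.2)) ((1 : ℝ), (0 : X)) (Icc 0 S.T) q.1 :=
    (hasDerivWithinAt_id _ _).prodMk (hasDerivWithinAt_const _ _ _)
  exact (h3.comp_hasDerivWithinAt (f := fun s : ℝ => (s, q.2)) q.1 h4
    (fun s hs => ⟨hs, mem_univ _⟩)).derivWithin (hu _ hq.1)

theorem cost_le_lintegral (t : ℝ) {ϑ : ℝ → X} {a b : ℝ} (hab : a < b)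
    (hϑ : AbsolutelyContinuousOnInterval ϑ a b) :
    S.cost t (ϑ a) (ϑ b) ≤
      ∫⁻ r in Ioo a b, ENNReal.ofReal (S.p (deriv ϑ r) (-S.DE t (ϑ r))) :=
  iInf_le_of_le a <| iInf_le_of_le b <| iInf_le_of_le ϑ <| iInf_le _ ⟨hab, hϑ, rfl, rfl⟩

theorem cost_self (t : ℝ) (a : X) : S.cost t a a = 0 := by
  have h := S.cost_le_lintegral t (ϑ := fun _ => a) zero_lt_one
    (LipschitzWith.const a).lipschitzOnWith.absolutelyContinuousOnInterval
  simpa [S.p_eq_contact, S.contact_zero_left (S.Ψconj_nonneg _)] using h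

variable {S} in
/-- The value of `Ψ*` at the driving force, as a function of the state, is lower semicontinuous. -/
theorem lowerSemicontinuous_Ψconj_DE {t : ℝ} (ht : t ∈ Icc 0 S.T) :
    LowerSemicontinuous fun x => S.Ψconj (-S.DE t x) :=
  S.lowerSemicontinuous_Ψconj.comp (continuous_DE ht).neg

variable [FiniteDimensional ℝ X]

variable {S} in
theorem ofReal_energy_le_lintegral {t : ℝ} (ht : t ∈ Icc 0 S.T) {ϑ : ℝ → X} {a b : ℝ}
    (hab : a ≤ b) (hϑ : AbsolutelyContinuousOnInterval ϑ a b) :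
    ENNReal.ofReal (S.E t (ϑ a) - S.E t (ϑ b)) ≤
      ∫⁻ r in Ioo a b, ENNReal.ofReal (S.p (deriv ϑ r) (-S.DE t (ϑ r))) := by
  have h := hϑ.ofReal_sub_le_lintegral (F := fun x => -S.E t x) hab (contDiff_E ht).neg
    (h := fun r => S.p (deriv ϑ r) (-S.DE t (ϑ r))) fun r _ => ?_
  · convert h using 2
    ring
  · have : fderiv ℝ (fun x => -S.E t x) (ϑ r) = -S.DE t (ϑ r) := fderiv_fun_neg
    rw [this]
    exact S.apply_le_p _ _

variable {S} in
theorem ofReal_energy_le_cost {t : ℝ} (ht : t ∈ Icc 0 S.T) (a b : X) :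
    ENNReal.ofReal (S.E t a - S.E t b) ≤ S.cost t a b := by
  refine le_iInf fun r₀ => le_iInf fun r₁ => le_iInf fun ϑ => le_iInf fun h => ?_
  obtain ⟨hlt, hac, rfl, rfl⟩ := h
  exact ofReal_energy_le_lintegral ht hlt.le hac

theorem ofReal_Ψ₀_le_cost (t : ℝ) (a b : X) : ENNReal.ofReal (S.Ψ₀ (b - a)) ≤ S.cost t a b := by
  refine le_iInf fun r₀ => le_iInf fun r₁ => le_iInf fun ϑ => le_iInf fun h => ?_
  obtain ⟨hlt, hac, rfl, rfl⟩ := h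
  exact hac.ofReal_sublinear_le_lintegral hlt.le S.Ψ₀_smul S.Ψ₀_add_le fun r _ => S.Ψ₀_le_p _ _

end RISystem

/-! ### Curves parametrized by their cost. -/

/-- The distribution function of a finite measure without atoms is continuous. -/
theorem continuous_measureReal_Iic {ρ : Measure ℝ} [IsFiniteMeasure ρ] [NullSingletonClass ρ] :
    Continuous fun r => ρ.real (Iic r) := by
  have h : (fun r => ρ.real (Iic r)) = fun r => ∫ y, (Iic r).indicator (fun _ => (1 : ℝ)) y ∂ρ := by
    ext r
    rw [integral_indicator measurableSet_Iic]
    simp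
  rw [h, continuous_iff_continuousAt]
  intro r
  refine continuousAt_of_dominated (bound := fun _ => 1)
    (Eventually.of_forall fun s => (measurable_const.indicator measurableSet_Iic).aestronglyMeasurable)
    (Eventually.of_forall fun s => Eventually.of_forall fun y => ?_) (integrable_const _) ?_
  · by_cases hy : y ∈ Iic s <;> simp [hy]
  · have hr : ∀ᵐ y ∂ρ, y ≠ r := by simp [ae_iff]
    filter_upwards [hr] with y hy
    rcases lt_or_gt_of_ne hy with h | h
    · refine (continuousAt_const (y := (1 : ℝ))).congr ?_
      filter_upwards [lt_mem_nhds h] with s hs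
      simp [hs.le]
    · refine (continuousAt_const (y := (0 : ℝ))).congr ?_
      filter_upwards [gt_mem_nhds h] with s hs
      simp [hs]

namespace RISystem

variable {X : Type*} [NormedAddCommGroup X] [NormedSpace ℝ X] (S : RISystem X)

/-- A curve parametrized in such a way that it spends cost at rate at most one, in a form that does
not involve derivatives. -/
def HasSlowIncrements (t : ℝ) (η : ℝ → X) : Prop :=
  ∀ r s, r ≤ s → ∀ μ, 0 ≤ μ → (∀ x ∈ Icc r s, μ ≤ S.Ψconj (-S.DE t (η x))) →
    S.contact (η s - η r) μ ≤ s - r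

/-- A Lipschitz curve that spends cost at rate at most one. -/
def IsSlowCurve (t : ℝ) (η : ℝ → X) : Prop :=
  (∃ K, LipschitzWith K η) ∧ ∀ᵐ r, S.p (deriv η r) (-S.DE t (η r)) ≤ 1

variable {S} {t : ℝ} {η : ℝ → X}

theorem HasSlowIncrements.Ψ₀_le (h : S.HasSlowIncrements t η) {r s : ℝ} (hrs : r ≤ s) :
    S.Ψ₀ (η s - η r) ≤ s - r := by
  rw [← S.contact_zero_right]
  exact h r s hrs 0 le_rfl fun x _ => S.Ψconj_nonneg _

theorem lipschitzWith_of_Ψ₀_le {c : NNReal} (hc : ∀ v : X, ‖v‖ ≤ c * S.Ψ₀ v)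
    (h : ∀ r s, r ≤ s → S.Ψ₀ (η s - η r) ≤ s - r) : LipschitzWith c η := by
  refine LipschitzWith.of_dist_le_mul fun x y => ?_
  wlog hxy : x ≤ y generalizing x y
  · rw [dist_comm, dist_comm x]
    exact this y x (le_of_not_ge hxy)
  rw [dist_comm, dist_eq_norm, dist_comm, Real.dist_eq, abs_of_nonneg (sub_nonneg.2 hxy)]
  exact (hc _).trans (by gcongr; exact h x y hxy)

/-- Slowness of a concatenation of slow curves. -/
theorem IsSlowCurve.concat {η₁ η₂ : ℝ → X} (h₁ : S.IsSlowCurve t η₁) (h₂ : S.IsSlowCurve t η₂)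
    {L : ℝ} (h : η₁ L = η₂ 0) :
    S.IsSlowCurve t (fun r => if r ≤ L then η₁ r else η₂ (r - L)) := by
  obtain ⟨⟨K₁, hK₁⟩, hp₁⟩ := h₁
  obtain ⟨⟨K₂, hK₂⟩, hp₂⟩ := h₂
  refine ⟨⟨max K₁ K₂, LipschitzWith.of_dist_le_mul fun x y => ?_⟩, ?_⟩
  · wlog hxy : x ≤ y generalizing x y
    · rw [dist_comm, dist_comm x]
      exact this y x (le_of_not_ge hxy)
    have e1 : ∀ x y, dist (η₁ x) (η₁ y) ≤ (max K₁ K₂ : NNReal) * dist x y := fun x y =>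
      (hK₁.dist_le_mul x y).trans (by gcongr; exact le_max_left _ _)
    have e2 : ∀ x y, dist (η₂ x) (η₂ y) ≤ (max K₁ K₂ : NNReal) * dist x y := fun x y =>
      (hK₂.dist_le_mul x y).trans (by gcongr; exact le_max_right _ _)
    by_cases hy : y ≤ L
    · simpa [hy, hxy.trans hy] using e1 x y
    by_cases hx : x ≤ L
    · have hd : dist x y = dist x L + dist 0 (y - L) := by
        rw [Real.dist_eq, Real.dist_eq, Real.dist_eq, abs_of_nonpos (by linarith),
          abs_of_nonpos (by linarith), abs_of_nonpos (by linarith)]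
        ring
      simp only [hx, hy, if_true, if_false]
      rw [hd, mul_add]
      refine (dist_triangle _ (η₁ L) _).trans (add_le_add (e1 _ _) ?_)
      rw [h]
      exact e2 _ _
    · simpa [hx, hy] using e2 (x - L) (y - L)
  · have hp₂' : ∀ᵐ r, S.p (deriv η₂ (r - L)) (-S.DE t (η₂ (r - L))) ≤ 1 :=
      (measurePreserving_sub_right volume L).quasiMeasurePreserving.ae hp₂
    have hL : ∀ᵐ r : ℝ, r ≠ L := by simp [ae_iff]
    filter_upwards [hp₁, hp₂', hL] with r h1 h2 hr
    rcases lt_or_gt_of_ne hr with hr | hr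
    · have he : (fun r => if r ≤ L then η₁ r else η₂ (r - L)) =ᶠ[𝓝 r] η₁ := by
        filter_upwards [gt_mem_nhds hr] with s hs
        simp [hs.le]
      rw [he.deriv_eq]
      simpa [hr.le] using h1
    · have he : (fun r => if r ≤ L then η₁ r else η₂ (r - L)) =ᶠ[𝓝 r] fun r => η₂ (r - L) := by
        filter_upwards [lt_mem_nhds hr] with s hs
        simp [hs]
      rw [he.deriv_eq, deriv_comp_sub_const]
      simpa [not_le.2 hr] using h2

theorem IsSlowCurve.cost_le (h : S.IsSlowCurve t η) {a b : ℝ} (hab : a ≤ b) :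
    S.cost t (η a) (η b) ≤ ENNReal.ofReal (b - a) := by
  obtain ⟨⟨K, hK⟩, hp⟩ := h
  rcases hab.eq_or_lt with rfl | hab
  · simp [S.cost_self]
  refine (S.cost_le_lintegral t hab hK.lipschitzOnWith.absolutelyContinuousOnInterval).trans ?_
  calc ∫⁻ r in Ioo a b, ENNReal.ofReal (S.p (deriv η r) (-S.DE t (η r)))
      ≤ ∫⁻ r in Ioo a b, 1 := by
        refine lintegral_mono_ae (ae_restrict_of_ae ?_)
        filter_upwards [hp] with r hr
        simpa using hr
    _ = ENNReal.ofReal (b - a) := by simp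

variable [FiniteDimensional ℝ X]

/-- Reparametrization of an absolutely continuous curve by its cost. -/
theorem exists_hasSlowIncrements {ϑ : ℝ → X} {a b L : ℝ} (hab : a ≤ b) (hL : 0 ≤ L)
    (hϑ : AbsolutelyContinuousOnInterval ϑ a b)
    (hcost : ∫⁻ r in Ioo a b, ENNReal.ofReal (S.p (deriv ϑ r) (-S.DE t (ϑ r))) ≤
      ENNReal.ofReal L) :
    ∃ η, S.HasSlowIncrements t η ∧ η 0 = ϑ a ∧ η L = ϑ b := by
  set f : ℝ → ℝ≥0∞ := fun r => ENNReal.ofReal (S.p (deriv ϑ r) (-S.DE t (ϑ r))) with hf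
  set ρ := (volume.restrict (Ioo a b)).withDensity f with hρ
  have hfin : IsFiniteMeasure ρ := by
    refine ⟨?_⟩
    rw [hρ, withDensity_apply f MeasurableSet.univ, Measure.restrict_univ]
    exact hcost.trans_lt ENNReal.ofReal_lt_top
  have hac : ρ ≪ volume :=
    (withDensity_absolutelyContinuous _ _).trans Measure.absolutelyContinuous_restrict
  have hna : NullSingletonClass ρ := ⟨fun x => hac (measure_singleton x)⟩
  -- `G` is the cost spent up to time `r`; it plays the role of arc length.
  set G : ℝ → ℝ := fun r => ρ.real (Iic r) with hG
  have hGc : Continuous G := continuous_measureReal_Iic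
  have hGmono : Monotone G := fun r s h => measureReal_mono (Iic_subset_Iic.2 h)
  have hGsub : ∀ r s, a ≤ r → r ≤ s → s ≤ b →
      ENNReal.ofReal (G s - G r) = ∫⁻ x in Ioo r s, f x := by
    intro r s har hrs hsb
    have h1 : G s - G r = ρ.real (Ioc r s) := by
      rw [← show Iic s \ Iic r = Ioc r s by ext; simp [and_comm], measureReal_sdiff (Iic_subset_Iic.2 hrs) measurableSet_Iic]
    rw [h1, ofReal_measureReal, hρ, withDensity_apply f measurableSet_Ioc,
      Measure.restrict_restrict measurableSet_Ioc]
    refine setLIntegral_congr ?_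
    have hs : ∀ᵐ x : ℝ, x ≠ s := by simp [ae_iff]
    filter_upwards [hs] with x hx
    refine propext ⟨fun h => ⟨h.1.1, lt_of_le_of_ne h.1.2 hx⟩, fun h => ⟨⟨h.1, h.2.le⟩, ?_⟩⟩
    exact ⟨har.trans_lt h.1, h.2.trans_le hsb⟩
  -- Jensen's inequality applies because `S.contact · μ` is sublinear once `μ` is frozen.
  have hincr : ∀ r s, a ≤ r → r ≤ s → s ≤ b → ∀ μ, 0 ≤ μ →
      (∀ x ∈ Icc r s, μ ≤ S.Ψconj (-S.DE t (ϑ x))) → S.contact (ϑ s - ϑ r) μ ≤ G s - G r := by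
    intro r s har hrs hsb μ hμ hx
    have h1 := (hϑ.mono (c := r) (d := s) (by
      rw [uIcc_of_le hrs, uIcc_of_le hab]; exact Icc_subset_Icc har hsb)).ofReal_sublinear_le_lintegral
      hrs (N := fun v => S.contact v μ) (S.contact_smul hμ) (S.contact_add_le hμ)
      (h := fun r => S.p (deriv ϑ r) (-S.DE t (ϑ r))) fun x hx' => by
        rw [S.p_eq_contact]
        exact S.contact_mono hμ (hx x (Ioo_subset_Icc_self hx')) _
    rw [← hGsub r s har hrs hsb] at h1
    exact (ENNReal.ofReal_le_ofReal_iff (sub_nonneg.2 (hGmono hrs))).1 h1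
  -- Where no cost is spent the curve stands still, since `Ψ₀` is positive off the origin. Composing
  -- `ϑ` with a right inverse of `G` is thus independent of the choice of that inverse.
  have hconst : ∀ r s, r ∈ Icc a b → s ∈ Icc a b → G r = G s → ϑ r = ϑ s := by
    intro r s hr hs h
    wlog hrs : r ≤ s generalizing r s
    · exact (this s r hs hr h.symm (le_of_not_ge hrs)).symm
    have h1 := hincr r s hr.1 hrs hs.2 0 le_rfl fun x _ => S.Ψconj_nonneg _
    rw [S.contact_zero_right, h, sub_self] at h1
    by_contra hne
    exact absurd (S.Ψ₀_pos (ϑ s - ϑ r) (sub_ne_zero.2 (Ne.symm hne))) (not_lt.2 h1)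
  have hGa : G a = 0 := by
    have h1 : Iic a ∩ Ioo a b = ∅ := by
      ext x
      simp only [mem_inter_iff, mem_Iic, mem_Ioo, mem_empty_iff_false, iff_false]
      intro h
      linarith [h.1, h.2.1]
    simp [hG, hρ, measureReal_def, withDensity_apply f measurableSet_Iic,
      Measure.restrict_restrict measurableSet_Iic, h1]
  have hGb : G b ≤ L := by
    have := hGsub a b le_rfl hab le_rfl
    rw [hGa, sub_zero] at this
    rw [← this] at hcost
    exact (ENNReal.ofReal_le_ofReal_iff hL).1 hcost
  have hsurj : ∀ y, ∃ r, y ∈ Icc (G a) (G b) → r ∈ Icc a b ∧ G r = y := by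
    intro y
    by_cases hy : y ∈ Icc (G a) (G b)
    · obtain ⟨r, hr, rfl⟩ := intermediate_value_Icc hab hGc.continuousOn hy
      exact ⟨r, fun _ => ⟨hr, rfl⟩⟩
    · exact ⟨0, fun h => absurd h hy⟩
  choose R hR using hsurj
  have hGab : G a ≤ G b := hGmono hab
  have hclamp : ∀ s : ℝ, max (G a) (min s (G b)) ∈ Icc (G a) (G b) := fun s =>
    ⟨le_max_left _ _, max_le hGab (min_le_right _ _)⟩
  -- Clamping to the range of `G` extends the curve to the whole line by constants.
  refine ⟨fun s => ϑ (R (max (G a) (min s (G b)))), ?_, ?_, ?_⟩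
  · intro r s hrs μ hμ hx
    set r' := max (G a) (min r (G b)) with hr'
    set s' := max (G a) (min s (G b)) with hs'
    have hle : r' ≤ s' := max_le_max le_rfl (min_le_min hrs le_rfl)
    rcases hle.eq_or_lt with heq | hlt
    · change S.contact (ϑ (R s') - ϑ (R r')) μ ≤ s - r
      rw [heq, sub_self, S.contact_zero_left hμ]
      linarith
    · obtain ⟨hr1, hr2⟩ := hR r' (hclamp r)
      obtain ⟨hs1, hs2⟩ := hR s' (hclamp s)
      have hRlt : R r' < R s' := by
        by_contra hcon
        have := hGmono (not_lt.1 hcon)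
        linarith
      -- As `r' < s'`, neither is `r` cut off from above nor `s` from below, so clamping can only
      -- shorten the interval.
      have hrr : r ≤ r' := by grind
      have hss : s' ≤ s := by grind
      refine (hincr _ _ hr1.1 hRlt.le hs1.2 μ hμ fun x hx' => ?_).trans (by linarith)
      have hxG : G x ∈ Icc r' s' := ⟨hr2 ▸ hGmono hx'.1, hs2 ▸ hGmono hx'.2⟩
      have hxab : x ∈ Icc a b := ⟨hr1.1.trans hx'.1, hx'.2.trans hs1.2⟩
      have hcl : max (G a) (min (G x) (G b)) = G x := by
        rw [min_eq_left (hGmono hxab.2), max_eq_right (hGmono hxab.1)]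
      have h2 := hx (G x) ⟨hrr.trans hxG.1, hxG.2.trans hss⟩
      obtain ⟨h3, h4⟩ := hR (G x) ⟨hGmono hxab.1, hGmono hxab.2⟩
      simp only [hcl] at h2
      rwa [hconst _ _ h3 hxab h4] at h2
  · obtain ⟨h1, h2⟩ := hR (max (G a) (min 0 (G b))) (hclamp 0)
    refine hconst _ _ h1 (left_mem_Icc.2 hab) ?_
    rw [h2, min_eq_left (hGa ▸ hGab), hGa, max_self]
  · obtain ⟨h1, h2⟩ := hR (max (G a) (min L (G b))) (hclamp L)
    refine hconst _ _ h1 (right_mem_Icc.2 hab) ?_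
    rw [h2, min_eq_right hGb, max_eq_right hGab]

end RISystem

/-! ### Compactness, existence of minimizing curves and the triangle inequality. -/

namespace RISystem

variable {X : Type*} [NormedAddCommGroup X] [NormedSpace ℝ X] {S : RISystem X} {t : ℝ}
  [FiniteDimensional ℝ X]

/-- If the increments of a Lipschitz curve at each point obey, to the right of that point, the cost
bounds with smaller values of `Ψ*`, then the curve is slow. -/
theorem isSlowCurve_of_eventually {η : ℝ → X} {K : NNReal} (hK : LipschitzWith K η)
    (h : ∀ r μ, 0 ≤ μ → (μ < S.Ψconj (-S.DE t (η r)) ∨ μ = 0) →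
      ∀ᶠ s in 𝓝[>] r, S.contact (η s - η r) μ ≤ s - r) : S.IsSlowCurve t η := by
  refine ⟨⟨K, hK⟩, ?_⟩
  filter_upwards [hK.ae_differentiableAt_real] with r hr
  have key : ∀ μ, 0 ≤ μ → (μ < S.Ψconj (-S.DE t (η r)) ∨ μ = 0) →
      S.contact (deriv η r) μ ≤ 1 := by
    intro μ hμ hlt
    have h1 : Tendsto (fun s => (s - r)⁻¹ • (η s - η r)) (𝓝[>] r) (𝓝 (deriv η r)) := by
      have := (hasDerivAt_iff_tendsto_slope.1 hr.hasDerivAt).mono_left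
        (nhdsWithin_mono r (fun s (hs : r < s) => hs.ne'))
      exact this
    refine le_of_tendsto (((S.continuous_contact hμ).tendsto _).comp h1) ?_
    filter_upwards [h r μ hμ hlt, self_mem_nhdsWithin] with s hs hrs
    have hpos : 0 < s - r := sub_pos.2 hrs
    simp only [Function.comp_apply]
    rw [S.contact_smul hμ _ _ (inv_nonneg.2 hpos.le), inv_mul_le_iff₀ hpos, mul_one]
    exact hs
  rw [S.p_eq_contact]
  rcases (S.Ψconj_nonneg (-S.DE t (η r))).eq_or_lt with h0 | hpos
  · rw [← h0]
    exact key 0 le_rfl (Or.inr rfl)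
  -- The hypothesis covers only values strictly below `Ψ*`, hence the passage `θ ↑ 1`.
  · have h1 : Tendsto (fun θ : ℝ => θ * S.contact (deriv η r) (S.Ψconj (-S.DE t (η r))))
        (𝓝[<] 1) (𝓝 (1 * S.contact (deriv η r) (S.Ψconj (-S.DE t (η r))))) :=
      (tendsto_nhdsWithin_of_tendsto_nhds tendsto_id).mul_const _
    rw [one_mul] at h1
    refine le_of_tendsto h1 ?_
    filter_upwards [Ioo_mem_nhdsLT zero_lt_one] with θ hθ
    refine (S.mul_contact_le hpos.le hθ.1.le hθ.2.le _).trans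
      (key _ (mul_nonneg hθ.1.le hpos.le) (Or.inl ?_))
    exact mul_lt_of_lt_one_left hpos hθ.2

/-- Compactness of curves parametrized by their cost. -/
theorem exists_isSlowCurve_of_tendsto (ht : t ∈ Icc 0 S.T) {η : ℕ → ℝ → X}
    (hη : ∀ n, S.HasSlowIncrements t (η n)) {L : ℕ → ℝ} {L' : ℝ} {a b : X}
    (ha : Tendsto (fun n => η n 0) atTop (𝓝 a)) (hL : Tendsto L atTop (𝓝 L'))
    (hb : Tendsto (fun n => η n (L n)) atTop (𝓝 b)) :
    ∃ ζ, S.IsSlowCurve t ζ ∧ ζ 0 = a ∧ ζ L' = b := by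
  obtain ⟨c, hc, hcΨ⟩ := S.exists_norm_le_Ψ₀
  have hlip : ∀ n, LipschitzWith c (η n) := fun n =>
    lipschitzWith_of_Ψ₀_le hcΨ fun r s hrs => (hη n).Ψ₀_le hrs
  obtain ⟨R, hR⟩ := (Metric.isBounded_range_of_tendsto _ ha).exists_norm_le
  have hbound : ∀ s n, η n s ∈ Metric.closedBall (0 : X) (R + c * |s|) := by
    intro s n
    have h1 := (hlip n).dist_le_mul s 0
    rw [Real.dist_eq, sub_zero, dist_eq_norm] at h1
    have h2 := hR _ (mem_range_self n)
    rw [mem_closedBall_zero_iff]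
    calc ‖η n s‖ = ‖η n 0 + (η n s - η n 0)‖ := by congr 1; abel
      _ ≤ _ := (norm_add_le _ _).trans (add_le_add h2 h1)
  have hU : ((hyperfilter ℕ : Ultrafilter ℕ) : Filter ℕ) ≤ atTop := Nat.hyperfilter_le_atTop
  -- Limits along a non-principal ultrafilter exist at all times simultaneously, so no subsequence
  -- has to be extracted.
  have hlim : ∀ s, ∃ x, Tendsto (fun n => η n s) (hyperfilter ℕ : Ultrafilter ℕ) (𝓝 x) := by
    intro s
    obtain ⟨x, -, hx⟩ := (isCompact_closedBall (0 : X) (R + c * |s|)).ultrafilter_le_nhds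
      ((hyperfilter ℕ).map fun n => η n s) (by
        rw [le_principal_iff]
        exact (Eventually.of_forall (hbound s) : ∀ᶠ n in (hyperfilter ℕ : Ultrafilter ℕ), _))
    exact ⟨x, hx⟩
  choose ζ hζ using hlim
  have hζΨ : ∀ r s, r ≤ s → S.Ψ₀ (ζ s - ζ r) ≤ s - r := fun r s hrs =>
    le_of_tendsto ((S.continuous_Ψ₀.tendsto _).comp ((hζ s).sub (hζ r)))
      (Eventually.of_forall fun n => (hη n).Ψ₀_le hrs)
  have hζlip : LipschitzWith c ζ := lipschitzWith_of_Ψ₀_le hcΨ hζΨ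
  refine ⟨ζ, isSlowCurve_of_eventually hζlip fun r μ hμ hlt => ?_, ?_, ?_⟩
  · rcases hlt with hlt | rfl
    -- By lower semicontinuity `Ψ*` stays above `μ` on the ball of radius `δ` about `ζ r`. Half of
    -- the radius absorbs the distance from `η n r` to `ζ r`, the other half the motion of a
    -- `c`-Lipschitz curve during a time `δ / 2 / c`.
    · obtain ⟨δ, hδ, hball⟩ := Metric.eventually_nhds_iff.1
        (lowerSemicontinuous_Ψconj_DE ht (ζ r) μ hlt)
      have hc' : (0 : ℝ) < c := hc
      have hpos : 0 < δ / 2 / c := by positivity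
      filter_upwards [Ioo_mem_nhdsGT (show r < r + δ / 2 / c by linarith)] with s hs
      refine le_of_tendsto (((S.continuous_contact hμ).tendsto _).comp ((hζ s).sub (hζ r))) ?_
      filter_upwards [(hζ r).eventually (Metric.ball_mem_nhds _ (half_pos hδ))] with n hn
      refine hη n r s hs.1.le μ hμ fun x hx => (hball ?_).le
      calc dist (η n x) (ζ r) ≤ dist (η n x) (η n r) + dist (η n r) (ζ r) := dist_triangle _ _ _
        _ < δ / 2 + δ / 2 := by
          refine add_lt_add_of_le_of_lt (((hlip n).dist_le_mul x r).trans ?_) hn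
          rw [Real.dist_eq, abs_of_nonneg (by linarith [hx.1])]
          rw [← le_div_iff₀' hc']
          linarith [hx.2, hs.2]
        _ = δ := by ring
    · filter_upwards [self_mem_nhdsWithin] with s hs
      rw [S.contact_zero_right]
      exact hζΨ r s (le_of_lt hs)
  · exact tendsto_nhds_unique (hζ 0) (ha.mono_left hU)
  · refine tendsto_nhds_unique (hζ L') ?_
    have h1 : Tendsto (fun n => dist (η n L') (η n (L n))) atTop (𝓝 0) := by
      refine squeeze_zero (fun n => dist_nonneg) (fun n => (hlip n).dist_le_mul _ _) ?_
      have := (tendsto_const_nhds (x := L')).dist hL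
      rw [dist_self] at this
      simpa using this.const_mul (c : ℝ)
    refine Tendsto.mono_left ?_ hU
    exact (tendsto_iff_of_dist h1).2 hb

/-- Closedness of sublevel sets of the cost, with a curve that realizes the bound. -/
theorem exists_isSlowCurve_of_cost_le (ht : t ∈ Icc 0 S.T) {a b : ℕ → X} {a' b' : X} {L : ℝ}
    (hL : 0 ≤ L) (ha : Tendsto a atTop (𝓝 a')) (hb : Tendsto b atTop (𝓝 b'))
    (h : ∀ n, S.cost t (a n) (b n) ≤ ENNReal.ofReal L) :
    ∃ ζ, S.IsSlowCurve t ζ ∧ ζ 0 = a' ∧ ζ L = b' := by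
  -- The infimum is not yet known to be attained, so the curves receive the extra duration `1 / (n +
  -- 1)`.
  have hex : ∀ n : ℕ, ∃ η, S.HasSlowIncrements t η ∧ η 0 = a n ∧ η (L + 1 / ((n : ℝ) + 1)) = b n := by
    intro n
    have hn : (0 : ℝ) < 1 / ((n : ℝ) + 1) := by positivity
    have h1 : S.cost t (a n) (b n) < ENNReal.ofReal (L + 1 / ((n : ℝ) + 1)) :=
      (h n).trans_lt ((ENNReal.ofReal_lt_ofReal_iff (by linarith)).2 (by linarith))
    simp only [cost, iInf_lt_iff] at h1
    obtain ⟨r₀, r₁, ϑ, ⟨hlt, hac, h0, h1⟩, hcost⟩ := h1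
    obtain ⟨η, h2, h3, h4⟩ := exists_hasSlowIncrements hlt.le (by linarith) hac hcost.le
    exact ⟨η, h2, h3.trans h0, h4.trans h1⟩
  choose η hη h0 h1 using hex
  refine exists_isSlowCurve_of_tendsto ht hη (L := fun n : ℕ => L + 1 / ((n : ℝ) + 1))
    (by simpa only [h0] using ha) ?_ (by simpa only [h1] using hb)
  simpa using (tendsto_const_nhds (x := L)).add tendsto_one_div_add_atTop_nhds_zero_nat

/-- Lower semicontinuity of the cost: the limit of almost minimizing curves is a slow curve of
duration `L`, and such a curve costs at most `L`. -/
theorem cost_le_of_tendsto (ht : t ∈ Icc 0 S.T) {a b : ℕ → X} {a' b' : X} {L : ℝ≥0∞}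
    (ha : Tendsto a atTop (𝓝 a')) (hb : Tendsto b atTop (𝓝 b'))
    (h : ∀ n, S.cost t (a n) (b n) ≤ L) : S.cost t a' b' ≤ L := by
  rcases eq_or_ne L ∞ with rfl | hL
  · exact le_top
  · obtain ⟨ζ, hζ, rfl, rfl⟩ := exists_isSlowCurve_of_cost_le ht ENNReal.toReal_nonneg ha hb
      (fun n => (h n).trans (ENNReal.ofReal_toReal hL).ge)
    refine (hζ.cost_le ENNReal.toReal_nonneg).trans ?_
    rw [sub_zero, ENNReal.ofReal_toReal hL]

theorem exists_isSlowCurve_cost (ht : t ∈ Icc 0 S.T) {a b : X} {L : ℝ} (hL : 0 ≤ L)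
    (h : S.cost t a b ≤ ENNReal.ofReal L) : ∃ ζ, S.IsSlowCurve t ζ ∧ ζ 0 = a ∧ ζ L = b :=
  exists_isSlowCurve_of_cost_le ht hL tendsto_const_nhds tendsto_const_nhds fun _ => h

/-- Minimizing slow curves are concatenated; their durations add up. -/
theorem cost_triangle (ht : t ∈ Icc 0 S.T) (a b c : X) :
    S.cost t a c ≤ S.cost t a b + S.cost t b c := by
  rcases eq_or_ne (S.cost t a b) ∞ with h1 | h1
  · simp [h1]
  rcases eq_or_ne (S.cost t b c) ∞ with h2 | h2
  · simp [h2]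
  have e1 := ENNReal.toReal_nonneg (a := S.cost t a b)
  have e2 := ENNReal.toReal_nonneg (a := S.cost t b c)
  obtain ⟨ζ₁, hζ₁, ha, hb⟩ := exists_isSlowCurve_cost ht e1 (ENNReal.ofReal_toReal h1).ge
  obtain ⟨ζ₂, hζ₂, hb', hc⟩ := exists_isSlowCurve_cost ht e2 (ENNReal.ofReal_toReal h2).ge
  have h := (hζ₁.concat hζ₂ (hb.trans hb'.symm)).cost_le (add_nonneg e1 e2)
  -- If the second curve has zero duration, the first branch is evaluated at the final time, and `b
  -- = c`.
  have hc' : (if (S.cost t a b).toReal + (S.cost t b c).toReal ≤ (S.cost t a b).toReal then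
      ζ₁ ((S.cost t a b).toReal + (S.cost t b c).toReal) else
      ζ₂ ((S.cost t a b).toReal + (S.cost t b c).toReal - (S.cost t a b).toReal)) = c := by
    split_ifs with hle
    · have h0 : (S.cost t b c).toReal = 0 := by linarith
      rw [h0] at hc
      rw [h0, add_zero, hb, ← hb', hc]
    · rw [add_sub_cancel_left, hc]
  simp only [e1, if_true, ha, hc', sub_zero] at h
  rwa [ENNReal.ofReal_add e1 e2, ENNReal.ofReal_toReal h1, ENNReal.ofReal_toReal h2] at h

end RISystem

/-! ### Optimal transitions. -/

/-- A continuous function that maps almost every point of an open interval into a closed set maps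
the closed interval into it. -/
theorem forall_mem_Icc_of_ae_mem_Ioo {Y : Type*} [TopologicalSpace Y] {f : ℝ → Y}
    (hf : Continuous f) {C : Set Y} (hC : IsClosed C) {a b : ℝ} (hab : a < b)
    (h : ∀ᵐ r, r ∈ Ioo a b → f r ∈ C) : ∀ r ∈ Icc a b, f r ∈ C := by
  intro r hr
  have h1 : Ioo a b ⊆ f ⁻¹' C := by
    intro s hs
    have h2 := (Measure.dense_of_ae h).open_subset_closure_inter isOpen_Ioo hs
    refine closure_minimal ?_ (hC.preimage hf) h2
    exact fun x hx => hx.2 hx.1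
  have h3 := closure_minimal h1 (hC.preimage hf)
  rw [closure_Ioo hab.ne] at h3
  exact h3 hr

namespace RISystem

variable {X : Type*} [NormedAddCommGroup X] [NormedSpace ℝ X] {S : RISystem X} {t : ℝ}

theorem ae_eq_one_of_le_lintegral {f : ℝ → ℝ} {L : ℝ} (hf : ∀ᵐ r, f r ≤ 1)
    (h : ENNReal.ofReal L ≤ ∫⁻ r in Ioo 0 L, ENNReal.ofReal (f r)) :
    ∀ᵐ r, r ∈ Ioo 0 L → f r = 1 := by
  have h1 : (fun r => ENNReal.ofReal (f r)) ≤ᵐ[volume.restrict (Ioo 0 L)] fun _ => 1 := by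
    refine ae_restrict_of_ae ?_
    filter_upwards [hf] with r hr
    simpa using hr
  have h2 : ∫⁻ r in Ioo (0 : ℝ) L, (1 : ℝ≥0∞) = ENNReal.ofReal L := by simp
  have h3 := ae_eq_of_ae_le_of_lintegral_le h1
    (ne_top_of_le_ne_top (h2 ▸ ENNReal.ofReal_ne_top) (lintegral_mono_ae h1))
    aemeasurable_const (h2.trans_le h)
  filter_upwards [(ae_restrict_iff' measurableSet_Ioo).1 h3] with r hr hmem
  simpa using hr hmem

variable [FiniteDimensional ℝ X]

/-- A `Ψ₀`-size as large as the duration leaves no slack in `Ψ₀ ≤ 𝔭 ≤ 1`, so `Ψ₀` and `𝔭` coincide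
at almost every velocity. Since these velocities are nonzero, `Ψ*` must vanish at the force;
continuity extends this to all times. -/
theorem IsSlowCurve.mem_Kstar (ht : t ∈ Icc 0 S.T) {ζ : ℝ → X} (hζ : S.IsSlowCurve t ζ) {L : ℝ}
    (hL : 0 < L) (h : L ≤ S.Ψ₀ (ζ L - ζ 0)) : ∀ r ∈ Icc 0 L, -S.DE t (ζ r) ∈ S.Kstar := by
  obtain ⟨⟨K, hK⟩, hp⟩ := hζ
  refine forall_mem_Icc_of_ae_mem_Ioo ((continuous_DE ht).comp hK.continuous).neg S.isClosed_Kstar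
    hL ?_
  have h1 := hK.lipschitzOnWith.absolutelyContinuousOnInterval (a := 0) (b := L)
    |>.ofReal_sublinear_le_lintegral hL.le S.Ψ₀_smul S.Ψ₀_add_le
    (h := fun r => S.Ψ₀ (deriv ζ r)) fun r _ => le_rfl
  have h2 := ae_eq_one_of_le_lintegral
    (hp.mono fun r hr => (S.Ψ₀_le_p (deriv ζ r) (-S.DE t (ζ r))).trans hr)
    ((ENNReal.ofReal_le_ofReal h).trans h1)
  filter_upwards [hp, h2] with r hr hr1 hmem
  rw [S.mem_Kstar_iff_Ψconj]
  refine S.eq_zero_of_contact_le (S.Ψconj_nonneg _) (v := deriv ζ r) ?_ (by rw [hr1 hmem]; exact hr)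
  intro h0
  have := hr1 hmem
  rw [h0, S.Ψ₀_zero] at this
  exact zero_ne_one this

/-- A slow curve whose duration is the cost and the released energy is an optimal transition. -/
theorem IsSlowCurve.isOptimalTransition (ht : t ∈ Icc 0 S.T) {ζ : ℝ → X}
    (hζ : S.IsSlowCurve t ζ) {L : ℝ} (hL : 0 < L) (hcost : S.cost t (ζ 0) (ζ L) = ENNReal.ofReal L)
    (hE : S.E t (ζ 0) - S.E t (ζ L) = L) :
    S.IsOptimalTransition t (ζ 0) (ζ L) ((0 : ℝ) : EReal) ((L : ℝ) : EReal)
      (fun r => ζ r.toReal) := by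
  obtain ⟨⟨K, hK⟩, hp⟩ := hζ
  have hac : AbsolutelyContinuousOnInterval ζ 0 L :=
    hK.lipschitzOnWith.absolutelyContinuousOnInterval
  have hpre : Real.toEReal ⁻¹' Ioo ((0 : ℝ) : EReal) ((L : ℝ) : EReal) = Ioo 0 L := by
    ext r
    simp only [mem_preimage, mem_Ioo, EReal.coe_lt_coe_iff]
  have hp1 : ∀ᵐ r, r ∈ Ioo 0 L → S.p (deriv ζ r) (-S.DE t (ζ r)) = 1 :=
    ae_eq_one_of_le_lintegral hp (hcost ▸ S.cost_le_lintegral t hL hac)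
  -- The released energy is the integral of this pairing, which is at most `𝔭 ≤ 1`, and it equals
  -- the duration.
  have hw1 : ∀ᵐ r, r ∈ Ioo 0 L → (-S.DE t (ζ r)) (deriv ζ r) = 1 := by
    refine ae_eq_one_of_le_lintegral (hp.mono fun r hr => (S.apply_le_p _ _).trans hr) ?_
    have h1 := hac.ofReal_sub_le_lintegral (F := fun x => -S.E t x) hL.le (contDiff_E ht).neg
      (h := fun r => (-S.DE t (ζ r)) (deriv ζ r)) fun r _ => by
        rw [show fderiv ℝ (fun x => -S.E t x) (ζ r) = -S.DE t (ζ r) from fderiv_fun_neg]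
    rwa [show -S.E t (ζ L) - -S.E t (ζ 0) = L by linarith] at h1
  refine ⟨EReal.coe_lt_coe_iff.2 hL, ?_, fun a b _ _ _ => ?_, ?_, by simp, by simp, ?_, ?_, ?_, ?_⟩
  · refine hK.continuous.comp_continuousOn (EReal.continuousOn_toReal.mono ?_)
    rintro r ⟨h0, h1⟩
    simp only [mem_compl_iff, mem_insert_iff, mem_singleton_iff, not_or]
    exact ⟨(lt_of_lt_of_le (EReal.bot_lt_coe 0) h0).ne',
      (lt_of_le_of_lt h1 (EReal.coe_lt_top L)).ne⟩
  · simpa using hK.lipschitzOnWith.absolutelyContinuousOnInterval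
  · rw [hpre]
    refine ne_top_of_le_ne_top ?_ (setLIntegral_mono (g := fun _ => (K : ℝ≥0∞))
      measurable_const fun r _ => ?_)
    · simp [ENNReal.mul_ne_top]
    · rw [enorm_le_coe]
      exact norm_deriv_le_of_lipschitz hK
  · filter_upwards [hp1] with r hr h0 h1 hd
    have := hr ⟨EReal.coe_lt_coe_iff.1 h0, EReal.coe_lt_coe_iff.1 h1⟩
    simp only [EReal.toReal_coe] at hd
    rw [hd, S.p_eq_contact, S.contact_zero_left (S.Ψconj_nonneg _)] at this
    exact zero_ne_one this
  -- The velocity itself is a competitor in the supremum: its `Ψ₀` is at most `1`, and its pairing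
  -- with the force is `1`.
  · have h1 : ∀ r ∈ Icc 0 L, S.Ψ₀star (-S.DE t (ζ r)) ∈ Ici (1 : ℝ) := by
      refine forall_mem_Icc_of_ae_mem_Ioo
        (S.continuous_Ψ₀star.comp ((continuous_DE ht).comp hK.continuous).neg) isClosed_Ici hL ?_
      filter_upwards [hp, hw1] with r hr hwr hmem
      rw [mem_Ici, ← hwr hmem]
      exact S.le_Ψ₀star _ ((S.Ψ₀_le_p _ _).trans hr)
    rintro r ⟨h2, h3⟩
    lift r to ℝ using ⟨(lt_of_le_of_lt h3 (EReal.coe_lt_top L)).ne,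
      (lt_of_lt_of_le (EReal.bot_lt_coe 0) h2).ne'⟩
    exact h1 r ⟨EReal.coe_le_coe_iff.1 h2, EReal.coe_le_coe_iff.1 h3⟩
  · rw [hcost, hE, EReal.coe_ennreal_ofReal, max_eq_left hL.le]
  · simp only [EReal.toReal_coe]
    rw [hpre, hcost, setLIntegral_congr_fun_ae measurableSet_Ioo (g := fun _ => 1)]
    · simp
    · filter_upwards [hp1] with r hr hmem
      simp [hr hmem]

/-- **Existence of optimal transitions** between states at which the released energy is the cost. -/
theorem exists_isOptimalTransition (ht : t ∈ Icc 0 S.T) {a b : X} (hab : a ≠ b)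
    (h : ((S.E t a - S.E t b : ℝ) : EReal) = (S.cost t a b : EReal)) :
    ∃ r₀ r₁ ϑ, S.IsOptimalTransition t a b r₀ r₁ ϑ := by
  have hL : 0 ≤ S.E t a - S.E t b := by
    have : (0 : EReal) ≤ ((S.E t a - S.E t b : ℝ) : EReal) := h ▸ EReal.coe_ennreal_nonneg _
    exact_mod_cast this
  have hcost : S.cost t a b = ENNReal.ofReal (S.E t a - S.E t b) := by
    rw [← EReal.coe_ennreal_eq_coe_ennreal_iff, ← h, EReal.coe_ennreal_ofReal, max_eq_left hL]
  obtain ⟨ζ, hζ, h0, h1⟩ := exists_isSlowCurve_cost ht hL hcost.le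
  -- Without released energy the curve would have zero duration and join `a` only to itself.
  rcases hL.eq_or_lt with h2 | h2
  · rw [← h2] at h1
    exact absurd (h0.symm.trans h1) hab
  have := hζ.isOptimalTransition ht h2 (by rw [h0, h1, hcost]) (by rw [h0, h1])
  rw [h0, h1] at this
  exact ⟨_, _, _, this⟩

/-- The cost between two points of a transition is at most the integral along it. -/
theorem IsOptimalTransition.cost_le (ht : t ∈ Icc 0 S.T) {um up : X} {r₀ r₁ : EReal}
    {ϑ : EReal → X} (h : S.IsOptimalTransition t um up r₀ r₁ ϑ) {r r' : EReal} (h0 : r₀ ≤ r)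
    (hr : r ≤ r') (h1 : r' ≤ r₁) :
    S.cost t (ϑ r) (ϑ r') ≤ ∫⁻ x in Real.toEReal ⁻¹' Ioo r r',
      ENNReal.ofReal (S.p (deriv (fun r : ℝ => ϑ r) x) (-S.DE t (ϑ x))) := by
  rcases hr.eq_or_lt with rfl | hr
  · simp [S.cost_self]
  -- The endpoints may be infinite. The interval is exhausted by bounded ones, and lower
  -- semicontinuity of the cost gives the limit.
  obtain ⟨c, hc, hc'⟩ := EReal.lt_iff_exists_real_btwn.1 hr
  obtain ⟨a, -, ha, hat⟩ := exists_seq_strictAnti_tendsto' hc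
  obtain ⟨b, -, hb, hbt⟩ := exists_seq_strictMono_tendsto' hc'
  have hcont : ∀ {x : EReal} {u : ℕ → EReal}, x ∈ Icc r₀ r₁ → (∀ n, u n ∈ Icc r₀ r₁) →
      Tendsto u atTop (𝓝 x) → Tendsto (fun n => ϑ (u n)) atTop (𝓝 (ϑ x)) := by
    intro x u hx hu hux
    exact (h.continuousOn x hx).tendsto.comp
      (tendsto_nhdsWithin_iff.2 ⟨hux, Eventually.of_forall hu⟩)
  refine cost_le_of_tendsto ht (hcont ⟨h0, hr.le.trans h1⟩ (fun n => ⟨?_, ?_⟩) hat)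
    (hcont ⟨h0.trans hr.le, h1⟩ (fun n => ⟨?_, ?_⟩) hbt) fun n => ?_
  · exact h0.trans (ha n).1.le
  · exact (ha n).2.le.trans (hc'.le.trans h1)
  · exact h0.trans (hc.le.trans (hb n).1.le)
  · exact (hb n).2.le.trans h1
  · obtain ⟨a', ha'⟩ : ∃ a' : ℝ, (a' : EReal) = a n := by
      lift a n to ℝ using ⟨((ha n).2.trans (EReal.coe_lt_top c)).ne, (bot_le.trans_lt (ha n).1).ne'⟩
        with a'
      exact ⟨a', rfl⟩
    obtain ⟨b', hb'⟩ : ∃ b' : ℝ, (b' : EReal) = b n := by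
      lift b n to ℝ using ⟨((hb n).2.trans_le le_top).ne, ((EReal.bot_lt_coe c).trans (hb n).1).ne'⟩
        with b'
      exact ⟨b', rfl⟩
    have hlt : a' < b' := by
      rw [← EReal.coe_lt_coe_iff, ha', hb']
      exact (ha n).2.trans (hb n).1
    rw [← ha', ← hb']
    refine (S.cost_le_lintegral t (ϑ := fun r : ℝ => ϑ r) hlt (h.absCont a' b' ?_ hlt.le ?_)).trans
      (lintegral_mono_set fun x hx => ⟨?_, ?_⟩)
    · rw [ha']; exact h0.trans (ha n).1.le
    · rw [hb']; exact (hb n).2.le.trans h1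
    · exact (ha n).1.trans (ha' ▸ EReal.coe_lt_coe_iff.2 hx.1)
    · exact (hb' ▸ EReal.coe_lt_coe_iff.2 hx.2 : (x : EReal) < b n).trans (hb n).2

/-- The cost splits at every point of an optimal transition. -/
theorem IsOptimalTransition.cost_add_cost_le (ht : t ∈ Icc 0 S.T) {um up : X} {r₀ r₁ : EReal}
    {ϑ : EReal → X} (h : S.IsOptimalTransition t um up r₀ r₁ ϑ) {r : EReal} (hr : r ∈ Icc r₀ r₁) :
    S.cost t um (ϑ r) + S.cost t (ϑ r) up ≤ S.cost t um up := by
  have h1 := h.cost_le ht le_rfl hr.1 hr.2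
  have h2 := h.cost_le ht hr.1 hr.2 le_rfl
  rw [h.start] at h1
  rw [h.finish] at h2
  refine (add_le_add h1 h2).trans ?_
  have hm : Measurable Real.toEReal := measurable_coe_real_ereal
  rw [h.cost_eq, ← lintegral_union (hm measurableSet_Ioo)]
  · refine lintegral_mono_set ?_
    rw [← preimage_union]
    refine preimage_mono (union_subset ?_ ?_)
    · exact Ioo_subset_Ioo_right hr.2
    · exact Ioo_subset_Ioo_left hr.1
  · refine Disjoint.preimage _ (disjoint_left.2 fun x hx hx' => ?_)
    exact lt_asymm hx.2 hx'.1

end RISystem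

/-! ### Vector measures on the line. -/

section VectorMeasure

variable {X : Type*} [NormedAddCommGroup X] [NormedSpace ℝ X]

/-- Two vector measures on the line that agree on half-open intervals are equal. -/
theorem MeasureTheory.VectorMeasure.ext_of_Ioc {M : Type*} [AddCommGroup M] [TopologicalSpace M]
    [T2Space M] {μ ν : VectorMeasure ℝ M} (h : ∀ a b, a < b → μ (Ioc a b) = ν (Ioc a b)) :
    μ = ν := by
  refine VectorMeasure.ext_of_generateFrom {S | ∃ l u, l < u ∧ Ioc l u = S} ?_ ?_
    (isPiSystem_Ioc id id) ?_
  · rintro _ ⟨l, u, hlu, rfl⟩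
    exact h l u hlu
  · exact BorelSpace.measurable_eq.trans (borel_eq_generateFrom_Ioc ℝ)
  · have hU : (univ : Set ℝ) = ⋃ n : ℕ, Ioc (-((n : ℝ) + 1)) ((n : ℝ) + 1) := by
      refine (eq_univ_of_forall fun x => mem_iUnion.2 ?_).symm
      obtain ⟨n, hn⟩ := exists_nat_gt |x|
      have := abs_lt.1 hn
      exact ⟨n, by linarith, by linarith⟩
    have hmono : Monotone fun n : ℕ => Ioc (-((n : ℝ) + 1)) ((n : ℝ) + 1) := by
      intro m n hmn
      have : (m : ℝ) ≤ n := by exact_mod_cast hmn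
      exact Ioc_subset_Ioc (by linarith) (by linarith)
    have h1 := μ.tendsto_vectorMeasure_iUnion_atTop_nat hmono fun n => measurableSet_Ioc
    have h2 := ν.tendsto_vectorMeasure_iUnion_atTop_nat hmono fun n => measurableSet_Ioc
    rw [← hU] at h1 h2
    refine tendsto_nhds_unique h1 (h2.congr fun n => ?_)
    have : (0 : ℝ) ≤ n := n.cast_nonneg
    exact (h _ _ (by linarith)).symm

/-- If the increments of a scalar component of a function of bounded variation are bounded by
those of a bounded monotone function, the same holds for the associated measures. -/
theorem BoundedVariationOn.apply_vectorMeasure_le [CompleteSpace X] {g : ℝ → X}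
    (hg : BoundedVariationOn g univ) {V : ℝ → ℝ} (hV : Monotone V) {C : ℝ} (hC : ∀ x, |V x| ≤ C)
    (ℓ : X →L[ℝ] ℝ) (hℓ : ∀ a b, a ≤ b → ℓ (g b - g a) ≤ V b - V a) {A : Set ℝ}
    (hA : MeasurableSet A) :
    ENNReal.ofReal (ℓ (hg.vectorMeasure A)) ≤ hV.stieltjesFunction.measure A := by
  -- The measure of the monotone function `V - ℓ ∘ g` is exactly the defect in the claimed
  -- inequality.
  have hW : Monotone fun x => V x - ℓ (g x) := by
    intro a b hab
    have := hℓ a b hab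
    rw [map_sub] at this
    simp only
    linarith
  have hWlim : ∀ x, Function.rightLim (fun x => V x - ℓ (g x)) x =
      Function.rightLim V x - ℓ (Function.rightLim g x) := fun x =>
    rightLim_eq_of_tendsto (by
      exact (hV.tendsto_rightLim x).sub ((ℓ.continuous.tendsto _).comp (hg.tendsto_rightLim x)))
  have hVfin : IsFiniteMeasure hV.stieltjesFunction.measure := by
    refine StieltjesFunction.isFiniteMeasure_of_forall_abs_le (C := C) _ fun x => ?_
    exact le_of_tendsto (hV.tendsto_rightLim x).abs (Eventually.of_forall hC)
  have hgb : ∀ x, |ℓ (g x)| ≤ ‖ℓ‖ * ((eVariationOn g univ).toReal + ‖g 0‖) := by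
    intro x
    have h1 := hg.dist_le (mem_univ x) (mem_univ 0)
    rw [dist_eq_norm] at h1
    refine (ℓ.le_opNorm (g x)).trans ?_
    gcongr
    calc ‖g x‖ = ‖(g x - g 0) + g 0‖ := by rw [sub_add_cancel]
      _ ≤ _ := (norm_add_le _ _).trans (by gcongr)
  have hWfin : IsFiniteMeasure hW.stieltjesFunction.measure := by
    refine StieltjesFunction.isFiniteMeasure_of_forall_abs_le
      (C := C + ‖ℓ‖ * ((eVariationOn g univ).toReal + ‖g 0‖)) _ fun x => ?_
    refine le_of_tendsto (hW.tendsto_rightLim x).abs (Eventually.of_forall fun y => ?_)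
    exact (abs_sub _ _).trans (add_le_add (hC y) (hgb y))
  have hc : Continuous (ℓ : X →+ ℝ) := ℓ.continuous
  have key : hV.stieltjesFunction.measure.toSignedMeasure =
      hW.stieltjesFunction.measure.toSignedMeasure +
        hg.vectorMeasure.mapRange (ℓ : X →+ ℝ) hc := by
    refine VectorMeasure.ext_of_Ioc fun a b hab => ?_
    rw [_root_.add_apply, Measure.toSignedMeasure_apply_measurable measurableSet_Ioc,
      Measure.toSignedMeasure_apply_measurable measurableSet_Ioc]
    change _ = _ + ℓ (hg.vectorMeasure (Ioc a b))
    rw [measureReal_def, measureReal_def, StieltjesFunction.measure_Ioc,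
      StieltjesFunction.measure_Ioc, hg.vectorMeasure_Ioc hab.le,
      ENNReal.toReal_ofReal (sub_nonneg.2 (hV.stieltjesFunction.mono hab.le)),
      ENNReal.toReal_ofReal (sub_nonneg.2 (hW.stieltjesFunction.mono hab.le)),
      hV.stieltjesFunction_eq, hV.stieltjesFunction_eq, hW.stieltjesFunction_eq,
      hW.stieltjesFunction_eq, hWlim, hWlim, map_sub]
    ring
  have h1 := congrArg (fun σ => σ A) key
  simp only [_root_.add_apply, Measure.toSignedMeasure_apply_measurable hA] at h1
  refine ENNReal.ofReal_le_of_le_toReal ?_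
  have h2 : 0 ≤ hW.stieltjesFunction.measure.real A := measureReal_nonneg
  change ℓ (hg.vectorMeasure A) ≤ hV.stieltjesFunction.measure.real A
  change _ = _ + ℓ (hg.vectorMeasure A) at h1
  linarith

variable [FiniteDimensional ℝ X]

/-- A finite-dimensional vector measure has finite variation. -/
theorem MeasureTheory.VectorMeasure.isFiniteMeasure_variation {α : Type*} [MeasurableSpace α]
    (ν : VectorMeasure α X) : IsFiniteMeasure ν.variation := by
  let b := Module.finBasis ℝ X
  have hc : ∀ i, Continuous (b.coord i : X →+ ℝ) := fun i =>
    (b.coord i).continuous_of_finiteDimensional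
  let σ : Fin (Module.finrank ℝ X) → SignedMeasure α := fun i =>
    ν.mapRange (b.coord i : X →+ ℝ) (hc i)
  have hle : ν.variation ≤ ∑ i, ‖b i‖₊ • (σ i).totalVariation := by
    refine VectorMeasure.variation_le_of_forall_enorm_le fun A _ => ?_
    have h1 : ν A = ∑ i, (σ i A) • b i := (b.sum_repr (ν A)).symm
    rw [h1, Measure.finsetSum_apply]
    refine (enorm_sum_le _ _).trans (Finset.sum_le_sum fun i _ => ?_)
    rw [enorm_smul, mul_comm]
    change ‖b i‖ₑ * _ ≤ ‖b i‖ₑ * _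
    gcongr
    exact SignedMeasure.enorm_le_totalVariation _ _
  have : ∀ i, IsFiniteMeasure (σ i).totalVariation := fun i => by
    unfold SignedMeasure.totalVariation
    infer_instance
  exact isFiniteMeasure_of_le _ hle

end VectorMeasure

/-! ### The variation function and the jump set. -/

namespace RISystem

variable {X : Type*} [NormedAddCommGroup X] [NormedSpace ℝ X] {S : RISystem X} {u : ℝ → X}

theorem ext_apply {t : ℝ} (ht : t ∈ Icc 0 S.T) : S.ext u t = u t := by
  simp [ext, min_eq_left ht.2, max_eq_right ht.1]

theorem left_zero : S.left u 0 = u 0 := by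
  refine leftLim_eq_of_tendsto (Tendsto.congr' ?_ tendsto_const_nhds)
  filter_upwards [self_mem_nhdsWithin] with s hs
  have : s ≤ 0 := le_of_lt hs
  simp [ext, min_eq_left (this.trans S.T_pos.le), max_eq_left this]

theorem right_T : S.right u S.T = u S.T := by
  refine rightLim_eq_of_tendsto (Tendsto.congr' ?_ tendsto_const_nhds)
  filter_upwards [self_mem_nhdsWithin] with s hs
  have : S.T ≤ s := le_of_lt hs
  simp [ext, min_eq_right this, max_eq_right S.T_pos.le]

theorem Var_self (a : ℝ) : S.Var u a a = 0 := by
  simp only [Var, ENNReal.iSup_eq_zero]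
  rintro M τ ⟨hτ, h0, hM⟩
  refine Finset.sum_eq_zero fun m hm => ?_
  have hm' := Finset.mem_range.1 hm
  have h1 : τ m = a := le_antisymm (hM ▸ hτ hm'.le) (h0 ▸ hτ (Nat.zero_le m))
  have h2 : τ (m + 1) = a := le_antisymm (hM ▸ hτ hm') (h0 ▸ hτ (Nat.zero_le _))
  rw [h1, h2, sub_self, S.Ψ₀_zero, ENNReal.ofReal_zero]

theorem Var_add_le {a b c : ℝ} (hbc : b ≤ c) (hab : a ≤ b) :
    S.Var u a b + ENNReal.ofReal (S.Ψ₀ (u c - u b)) ≤ S.Var u a c := by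
  -- With a single nonempty index type, the addition of a constant commutes with the supremum.
  have hne : S.Var u a b = ⨆ p : {p : ℕ × (ℕ → ℝ) // Monotone p.2 ∧ p.2 0 = a ∧ p.2 p.1 = b},
      ∑ m ∈ Finset.range p.1.1, ENNReal.ofReal (S.Ψ₀ (u (p.1.2 (m + 1)) - u (p.1.2 m))) := by
    rw [iSup_subtype, iSup_prod]
    rfl
  have : Nonempty {p : ℕ × (ℕ → ℝ) // Monotone p.2 ∧ p.2 0 = a ∧ p.2 p.1 = b} := by
    refine ⟨⟨(1, fun m => if m = 0 then a else b), fun m n hmn => ?_, by simp, by simp⟩⟩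
    by_cases hm : m = 0 <;> by_cases hn : n = 0 <;> simp [hm, hn] <;> first | exact hab | omega
  rw [hne, ENNReal.iSup_add]
  refine iSup_le ?_
  rintro ⟨⟨M, τ⟩, hτ, h0, hM⟩
  simp only at hτ h0 hM ⊢
  refine le_iSup_of_le (M + 1) (le_iSup_of_le (fun m => if m ≤ M then τ m else c)
    (le_iSup_of_le ⟨fun m n hmn => ?_, by simpa using h0, by simp⟩ ?_))
  · by_cases hn : n ≤ M
    · simpa [hn, hmn.trans hn] using hτ hmn
    · by_cases hm : m ≤ M
      · simpa [hn, hm] using (hτ hm).trans (hM.trans_le hbc)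
      · simp [hn, hm]
  · rw [Finset.sum_range_succ]
    refine add_le_add (Finset.sum_le_sum fun m hm => ?_) ?_
    · have hm' := Finset.mem_range.1 hm
      simp [hm'.le, Nat.succ_le_of_lt hm']
    · simp [hM]

theorem clamp_mem (t : ℝ) : max 0 (min t S.T) ∈ Icc 0 S.T :=
  ⟨le_max_left _ _, max_le S.T_pos.le (min_le_right _ _)⟩

theorem eq_of_Ψ₀_sub_le_zero {v w : X} (h : S.Ψ₀ (v - w) ≤ 0) : w = v := by
  by_contra hne
  exact absurd (S.Ψ₀_pos _ (sub_ne_zero.2 (Ne.symm hne))) (not_lt.2 h)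

variable [FiniteDimensional ℝ X]

theorem IsBV.tendsto_left (hu : S.IsBV u) (t : ℝ) :
    Tendsto (S.ext u) (𝓝[<] t) (𝓝 (S.left u t)) := by
  have := FiniteDimensional.complete ℝ X
  exact hu.ext.tendsto_leftLim t

theorem IsBV.tendsto_right (hu : S.IsBV u) (t : ℝ) :
    Tendsto (S.ext u) (𝓝[>] t) (𝓝 (S.right u t)) := by
  have := FiniteDimensional.complete ℝ X
  exact hu.ext.tendsto_rightLim t

theorem IsBV.Var_ne_top (hu : S.IsBV u) {t : ℝ} (ht : t ∈ Icc 0 S.T) : S.Var u 0 t ≠ ∞ := by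
  obtain ⟨C, hC⟩ := S.exists_Ψ₀_le_norm
  refine ne_top_of_le_ne_top (ENNReal.mul_ne_top (ENNReal.coe_ne_top (r := C)) hu)
    (iSup_le fun M => iSup_le fun τ => iSup_le ?_)
  rintro ⟨hτ, h0, hM⟩
  refine le_trans ?_ (mul_le_mul_right (eVariationOn.sum_le_of_monotoneOn_Iic (s := Icc 0 S.T) (n := M) (u := τ)
    (hτ.monotoneOn _) fun i hi => ⟨h0 ▸ hτ (Nat.zero_le i), (hM ▸ hτ hi).trans ht.2⟩) (C : ℝ≥0∞))
  rw [Finset.mul_sum]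
  refine Finset.sum_le_sum fun m _ => ?_
  rw [edist_eq_enorm_sub]
  refine (ENNReal.ofReal_le_ofReal (hC _)).trans ?_
  rw [ENNReal.ofReal_mul C.coe_nonneg, ofReal_norm, ENNReal.ofReal_coe_nnreal]

/-- The real-valued variation function `t ↦ Var(u; 0, t)`, extended constantly to the line. -/
noncomputable def varFun (S : RISystem X) (u : ℝ → X) (t : ℝ) : ℝ :=
  (S.Var u 0 (max 0 (min t S.T))).toReal

theorem IsBV.Ψ₀_sub_le_varFun (hu : S.IsBV u) {a b : ℝ} (hab : a ≤ b) :
    S.Ψ₀ (S.ext u b - S.ext u a) ≤ S.varFun u b - S.varFun u a := by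
  have hab' : max 0 (min a S.T) ≤ max 0 (min b S.T) := max_le_max le_rfl (min_le_min hab le_rfl)
  have h := S.Var_add_le (u := u) hab' (le_max_left _ _)
  have h1 := ENNReal.toReal_mono (hu.Var_ne_top (clamp_mem b)) h
  rw [ENNReal.toReal_add (hu.Var_ne_top (clamp_mem a)) ENNReal.ofReal_ne_top,
    ENNReal.toReal_ofReal (S.Ψ₀_nonneg _)] at h1
  change S.Ψ₀ (u _ - u _) ≤ (S.Var u 0 _).toReal - (S.Var u 0 _).toReal
  linarith

theorem IsBV.monotone_varFun (hu : S.IsBV u) : Monotone (S.varFun u) := fun a b hab => by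
  have := hu.Ψ₀_sub_le_varFun hab
  linarith [S.Ψ₀_nonneg (S.ext u b - S.ext u a)]

theorem IsBV.abs_varFun_le (hu : S.IsBV u) (t : ℝ) : |S.varFun u t| ≤ S.varFun u S.T := by
  have h1 : 0 ≤ S.varFun u t := ENNReal.toReal_nonneg
  rw [abs_of_nonneg h1]
  rcases le_total t S.T with h | h
  · exact hu.monotone_varFun h
  · simp [varFun, h]

theorem IsBV.Ψ₀_sub_left_le (hu : S.IsBV u) (t : ℝ) :
    S.Ψ₀ (S.ext u t - S.left u t) ≤ S.varFun u t - Function.leftLim (S.varFun u) t := by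
  refine le_of_tendsto_of_tendsto ((S.continuous_Ψ₀.tendsto _).comp
    (tendsto_const_nhds.sub (hu.tendsto_left t)))
    (tendsto_const_nhds.sub (hu.monotone_varFun.tendsto_leftLim t)) ?_
  filter_upwards [self_mem_nhdsWithin] with s hs using hu.Ψ₀_sub_le_varFun (le_of_lt hs)

theorem IsBV.Ψ₀_right_sub_le (hu : S.IsBV u) (t : ℝ) :
    S.Ψ₀ (S.right u t - S.ext u t) ≤ Function.rightLim (S.varFun u) t - S.varFun u t := by
  refine le_of_tendsto_of_tendsto ((S.continuous_Ψ₀.tendsto _).comp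
    ((hu.tendsto_right t).sub tendsto_const_nhds))
    ((hu.monotone_varFun.tendsto_rightLim t).sub tendsto_const_nhds) ?_
  filter_upwards [self_mem_nhdsWithin] with s hs using hu.Ψ₀_sub_le_varFun (le_of_lt hs)

/-- Jumps of `u` are controlled by those of the monotone variation function, which has countably
many discontinuities. -/
theorem IsBV.countable_jumpSet (hu : S.IsBV u) : (S.jumpSet u).Countable := by
  refine Set.Countable.mono ?_ hu.monotone_varFun.countable_not_continuousAt
  intro t ht
  change ¬ ContinuousAt (S.varFun u) t
  intro hc
  have h1 := hu.monotone_varFun.continuousAt_iff_leftLim_eq_rightLim.1 hc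
  have h2 := hu.monotone_varFun.leftLim_le (le_refl t)
  have h3 := hu.monotone_varFun.le_rightLim (le_refl t)
  have h4 := eq_of_Ψ₀_sub_le_zero ((hu.Ψ₀_sub_left_le t).trans (by linarith))
  have h5 := eq_of_Ψ₀_sub_le_zero ((hu.Ψ₀_right_sub_le t).trans (by linarith))
  rw [ext_apply ht.1] at h4 h5
  exact ht.2.elim (fun h => h h4) fun h => h h5

end RISystem

/-! ### Diffuse part and atoms of the derivative. -/

theorem ENNReal.ofReal_le_tsum_of_hasSum {ι : Type*} {f : ι → ℝ} {a : ℝ} {c : ι → ℝ≥0∞}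
    (hf : HasSum f a) (h : ∀ i, ENNReal.ofReal (f i) ≤ c i) : ENNReal.ofReal a ≤ ∑' i, c i := by
  refine le_of_tendsto ((ENNReal.continuous_ofReal.tendsto a).comp hf)
    (Eventually.of_forall fun F => ?_)
  refine (Finset.le_sum_of_subadditive ENNReal.ofReal ENNReal.ofReal_zero.le
    (fun _ _ => ENNReal.ofReal_add_le) F f).trans ?_
  exact (Finset.sum_le_sum fun i _ => h i).trans (ENNReal.sum_le_tsum F)

namespace RISystem

variable {X : Type*} [NormedAddCommGroup X] [NormedSpace ℝ X] {S : RISystem X} {u : ℝ → X}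

theorem left_of_le {t : ℝ} (ht : t ≤ 0) : S.left u t = u 0 := by
  refine leftLim_eq_of_tendsto (Tendsto.congr' ?_ tendsto_const_nhds)
  filter_upwards [self_mem_nhdsWithin] with s hs
  have : s ≤ 0 := (le_of_lt hs).trans ht
  simp [ext, min_eq_left (this.trans S.T_pos.le), max_eq_left this]

theorem right_of_le {t : ℝ} (ht : S.T ≤ t) : S.right u t = u S.T := by
  refine rightLim_eq_of_tendsto (Tendsto.congr' ?_ tendsto_const_nhds)
  filter_upwards [self_mem_nhdsWithin] with s hs
  have : S.T ≤ s := ht.trans (le_of_lt hs)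
  simp [ext, min_eq_right this, max_eq_right S.T_pos.le]

theorem left_eq_right {t : ℝ} (ht : t ∉ S.jumpSet u) : S.left u t = S.right u t := by
  by_cases h : t ∈ Icc 0 S.T
  · by_contra hne
    refine ht ⟨h, ?_⟩
    by_contra! h2
    exact hne (h2.1.trans h2.2)
  · rw [mem_Icc, not_and_or, not_le, not_le] at h
    rcases h with h | h
    · rw [left_of_le h.le]
      refine (rightLim_eq_of_tendsto (Tendsto.congr' ?_ tendsto_const_nhds)).symm
      filter_upwards [mem_nhdsWithin_of_mem_nhds (Iio_mem_nhds h)] with s hs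
      have : s ≤ 0 := le_of_lt hs
      simp [ext, min_eq_left (this.trans S.T_pos.le), max_eq_left this]
    · rw [right_of_le h.le]
      refine leftLim_eq_of_tendsto (Tendsto.congr' ?_ tendsto_const_nhds)
      filter_upwards [mem_nhdsWithin_of_mem_nhds (Ioi_mem_nhds h)] with s hs
      have : S.T ≤ s := le_of_lt hs
      simp [ext, min_eq_right this, max_eq_right S.T_pos.le]

/-- The left jump of `u`, measured by `Ψ₀`. -/
noncomputable def leftΨ₀ (S : RISystem X) (u : ℝ → X) (t : ℝ) : ℝ≥0∞ :=
  ENNReal.ofReal (S.Ψ₀ (u t - S.left u t))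

/-- The right jump of `u`, measured by `Ψ₀`. -/
noncomputable def rightΨ₀ (S : RISystem X) (u : ℝ → X) (t : ℝ) : ℝ≥0∞ :=
  ENNReal.ofReal (S.Ψ₀ (S.right u t - u t))

theorem leftΨ₀_eq_zero {t : ℝ} (h : S.left u t = u t) : S.leftΨ₀ u t = 0 := by
  simp [leftΨ₀, h, S.Ψ₀_zero]

theorem rightΨ₀_eq_zero {t : ℝ} (h : u t = S.right u t) : S.rightΨ₀ u t = 0 := by
  simp [rightΨ₀, ← h, S.Ψ₀_zero]

variable [FiniteDimensional ℝ X]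

/-- The distributional derivative of a function of bounded variation. -/
noncomputable def IsBV.derivMeasure (hu : S.IsBV u) : VectorMeasure ℝ X :=
  haveI := FiniteDimensional.complete ℝ X
  hu.ext.vectorMeasure

theorem IsBV.derivMeasure_singleton (hu : S.IsBV u) (t : ℝ) :
    hu.derivMeasure {t} = S.right u t - S.left u t := by
  have := FiniteDimensional.complete ℝ X
  exact hu.ext.vectorMeasure_singleton

theorem IsBV.derivMeasure_Ioo (hu : S.IsBV u) {a b : ℝ} (hab : a < b) :
    hu.derivMeasure (Ioo a b) = S.left u b - S.right u a := by
  have := FiniteDimensional.complete ℝ X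
  exact hu.ext.vectorMeasure_Ioo hab

theorem IsBV.measurableSet_jumpSet (hu : S.IsBV u) : MeasurableSet (S.jumpSet u) :=
  hu.countable_jumpSet.measurableSet

theorem IsBV.diffuse_apply (hu : S.IsBV u) {A : Set ℝ} (hA : MeasurableSet A) :
    S.diffuse hu A = hu.derivMeasure (A \ S.jumpSet u) :=
  VectorMeasure.restrict_apply _ hu.measurableSet_jumpSet.compl hA

theorem IsBV.diffuse_singleton (hu : S.IsBV u) (t : ℝ) : S.diffuse hu {t} = 0 := by
  rw [hu.diffuse_apply (measurableSet_singleton t)]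
  by_cases ht : t ∈ S.jumpSet u
  · rw [sdiff_eq_bot_iff.2 (singleton_subset_iff.2 ht)]
    exact VectorMeasure.empty _
  · rw [sdiff_eq_left.2 (disjoint_singleton_left.2 ht), hu.derivMeasure_singleton,
      left_eq_right ht, sub_self]

theorem IsBV.isFiniteMeasure_refMeasure (hu : S.IsBV u) : IsFiniteMeasure (S.refMeasure hu) := by
  have := (S.diffuse hu).isFiniteMeasure_variation
  unfold refMeasure
  infer_instance

theorem IsBV.refMeasure_singleton (hu : S.IsBV u) (t : ℝ) : S.refMeasure hu {t} = 0 := by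
  rw [refMeasure, Measure.add_apply, measure_singleton, zero_add,
    VectorMeasure.variation_apply_eq_zero (measurableSet_singleton t)]
  intro A hA _
  rcases subset_singleton_iff_eq.1 hA with rfl | rfl
  · exact VectorMeasure.empty _
  · exact hu.diffuse_singleton t

theorem IsBV.diffuseCoord_absolutelyContinuous (hu : S.IsBV u)
    (i : Fin (Module.finrank ℝ X)) :
    S.diffuseCoord hu i ≪ᵥ (S.refMeasure hu).toENNRealVectorMeasure := by
  refine VectorMeasure.AbsolutelyContinuous.mk fun A hA h => ?_
  rw [Measure.toENNRealVectorMeasure_apply_measurable hA] at h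
  have h1 : (S.diffuse hu).variation A = 0 := by
    rw [refMeasure, Measure.add_apply, add_eq_zero] at h
    exact h.2
  have h2 := (S.diffuse hu).enorm_measure_le_variation A
  rw [h1, nonpos_iff_eq_zero, enorm_eq_zero] at h2
  change (Module.finBasis ℝ X).coord i (S.diffuse hu A) = 0
  rw [h2, map_zero]

theorem IsBV.integrable_density (hu : S.IsBV u) :
    Integrable (S.density hu) (S.refMeasure hu) :=
  integrable_finsetSum _ fun _ _ => (SignedMeasure.integrable_rnDeriv _ _).smul_const _

theorem IsBV.setIntegral_density (hu : S.IsBV u) {A : Set ℝ} (hA : MeasurableSet A) :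
    ∫ t in A, S.density hu t ∂(S.refMeasure hu) = S.diffuse hu A := by
  have := hu.isFiniteMeasure_refMeasure
  have := FiniteDimensional.complete ℝ X
  unfold density
  rw [integral_finsetSum _ fun i _ =>
    ((SignedMeasure.integrable_rnDeriv _ _).smul_const _).integrableOn]
  rw [← (Module.finBasis ℝ X).sum_repr (S.diffuse hu A)]
  refine Finset.sum_congr rfl fun i _ => ?_
  rw [integral_smul_const, ← withDensityᵥ_apply (SignedMeasure.integrable_rnDeriv _ _) hA,
    SignedMeasure.withDensityᵥ_rnDeriv_eq _ _ (hu.diffuseCoord_absolutelyContinuous i)]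
  rfl

theorem IsBV.setIntegral_apply_density (hu : S.IsBV u) (ℓ : X →L[ℝ] ℝ) {A : Set ℝ}
    (hA : MeasurableSet A) :
    ∫ t in A, ℓ (S.density hu t) ∂(S.refMeasure hu) = ℓ (S.diffuse hu A) := by
  have := FiniteDimensional.complete ℝ X
  rw [ℓ.integral_comp_comm hu.integrable_density.integrableOn, hu.setIntegral_density hA]

/-- The measure with diffuse part `Ψ₀(u'_co)` and with atoms of mass `c s` at the jump times. -/
noncomputable def IsBV.varMeasure (hu : S.IsBV u) (c : ℝ → ℝ≥0∞) : Measure ℝ :=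
  (S.refMeasure hu).withDensity (fun t => ENNReal.ofReal (S.Ψ₀ (S.density hu t))) +
    (Measure.count.restrict (S.jumpSet u)).withDensity c

theorem IsBV.varMeasure_apply (hu : S.IsBV u) (c : ℝ → ℝ≥0∞) {A : Set ℝ}
    (hA : MeasurableSet A) :
    hu.varMeasure c A = ∫⁻ t in A, ENNReal.ofReal (S.Ψ₀ (S.density hu t)) ∂(S.refMeasure hu) +
      ∑' s : ↥(S.jumpSet u ∩ A), c s := by
  rw [varMeasure, Measure.add_apply, withDensity_apply _ hA, withDensity_apply _ hA,
    Measure.restrict_restrict hA, inter_comm A,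
    lintegral_countable _ (hu.countable_jumpSet.mono inter_subset_left)]
  simp

theorem IsBV.varMeasure_singleton (hu : S.IsBV u) (c : ℝ → ℝ≥0∞) {t : ℝ}
    (h : t ∉ S.jumpSet u → c t = 0) : hu.varMeasure c {t} = c t := by
  rw [hu.varMeasure_apply c (measurableSet_singleton t),
    setLIntegral_measure_zero _ _ (hu.refMeasure_singleton t), zero_add]
  by_cases ht : t ∈ S.jumpSet u
  · rw [inter_eq_right.2 (singleton_subset_iff.2 ht)]
    exact tsum_singleton t c
  · rw [h ht, inter_singleton_eq_empty.2 ht]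
    exact tsum_empty

/-- The variation on `[a,b]` whose diffuse part is that of `Var`, and whose jumps contribute
`cl t` and `cr t` on the left and on the right of `t`. -/
noncomputable def IsBV.jumpCostVar (hu : S.IsBV u) (cl cr : ℝ → ℝ≥0∞) (a b : ℝ) : ℝ≥0∞ :=
  if a < b then cr a + hu.varMeasure (fun t => cl t + cr t) (Ioo a b) + cl b else 0

/-- This puts the pseudo-variation into the form that it shares with the `Ψ₀`-variation. -/
theorem IsBV.pVar_eq (hu : S.IsBV u) (a b : ℝ) :
    S.pVar hu a b = hu.jumpCostVar (fun t => S.cost t (S.left u t) (u t))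
      (fun t => S.cost t (u t) (S.right u t)) a b := by
  unfold pVar jumpCostVar
  split_ifs
  · rw [hu.varMeasure_apply _ measurableSet_Ioo]
    unfold diffuseVar jumpVar
    ring
  · rfl

/-- The measure of total variation bounds the components of the derivative. -/
theorem IsBV.apply_derivMeasure_le (hu : S.IsBV u) {ℓ : X →L[ℝ] ℝ} (hℓ : ℓ ∈ S.Kstar) {A : Set ℝ}
    (hA : MeasurableSet A) :
    ENNReal.ofReal (ℓ (hu.derivMeasure A)) ≤
      hu.varMeasure (fun t => S.leftΨ₀ u t + S.rightΨ₀ u t) A := by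
  have hJ := hu.measurableSet_jumpSet
  have h1 : hu.derivMeasure A = S.diffuse hu A + hu.derivMeasure (S.jumpSet u ∩ A) := by
    rw [hu.diffuse_apply hA, ← VectorMeasure.of_union
      (disjoint_sdiff_left.mono_right inter_subset_left) (hA.diff hJ) (hJ.inter hA),
      inter_comm, sdiff_union_inter]
  have hc : (S.jumpSet u ∩ A).Countable := hu.countable_jumpSet.mono inter_subset_left
  rw [hu.varMeasure_apply _ hA, h1, map_add]
  refine ENNReal.ofReal_add_le.trans (add_le_add ?_ ?_)
  · rw [← hu.setIntegral_apply_density ℓ hA]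
    refine (ofReal_integral_le_lintegral_ofReal
      (ℓ.integrable_comp hu.integrable_density).integrableOn).trans ?_
    exact lintegral_mono fun t => ENNReal.ofReal_le_ofReal (hℓ _)
  · have := hc.to_subtype
    have h2 : HasSum (fun s : ↥(S.jumpSet u ∩ A) => hu.derivMeasure {(s : ℝ)})
        (hu.derivMeasure (S.jumpSet u ∩ A)) := by
      have := hu.derivMeasure.hasSum_of_disjoint_iUnion
        (f := fun s : ↥(S.jumpSet u ∩ A) => {(s : ℝ)}) (fun s => measurableSet_singleton _)
        fun s s' h => disjoint_singleton.2 fun h' => h (Subtype.ext h')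
      rwa [iUnion_of_singleton_coe] at this
    refine ENNReal.ofReal_le_tsum_of_hasSum (h2.mapL ℓ) fun s => ?_
    rw [hu.derivMeasure_singleton, leftΨ₀, rightΨ₀,
      ← ENNReal.ofReal_add (S.Ψ₀_nonneg _) (S.Ψ₀_nonneg _)]
    refine ENNReal.ofReal_le_ofReal ((hℓ _).trans ?_)
    rw [← sub_add_sub_cancel' (u s) (S.left u s)]
    exact S.Ψ₀_add_le _ _

end RISystem

/-! ### Representation of the `Ψ₀`-variation. -/

namespace RISystem

variable {X : Type*} [NormedAddCommGroup X] [NormedSpace ℝ X] {S : RISystem X} {u : ℝ → X}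

theorem zero_mem_Kstar : (0 : X →L[ℝ] ℝ) ∈ S.Kstar := fun z => S.Ψ₀_nonneg z

variable [FiniteDimensional ℝ X]

theorem exists_mem_Kstar_apply_eq (v : X) : ∃ ℓ ∈ S.Kstar, ℓ v = S.Ψ₀ v := by
  obtain ⟨g, hg, hle⟩ := exists_clm_le_sublinear_eq S.Ψ₀_smul S.Ψ₀_add_le v
  exact ⟨g, hle, hg⟩

/-- The Stieltjes measure of the variation function. -/
noncomputable def IsBV.dVar (hu : S.IsBV u) : Measure ℝ :=
  hu.monotone_varFun.stieltjesFunction.measure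

theorem IsBV.isFiniteMeasure_dVar (hu : S.IsBV u) : IsFiniteMeasure hu.dVar :=
  StieltjesFunction.isFiniteMeasure_of_forall_abs_le (C := S.varFun u S.T) _ fun x =>
    le_of_tendsto (hu.monotone_varFun.tendsto_rightLim x).abs
      (Eventually.of_forall hu.abs_varFun_le)

theorem IsBV.apply_derivMeasure_le_dVar (hu : S.IsBV u) {ℓ : X →L[ℝ] ℝ} (hℓ : ℓ ∈ S.Kstar)
    {A : Set ℝ} (hA : MeasurableSet A) :
    ENNReal.ofReal (ℓ (hu.derivMeasure A)) ≤ hu.dVar A := by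
  have := FiniteDimensional.complete ℝ X
  exact hu.ext.apply_vectorMeasure_le hu.monotone_varFun hu.abs_varFun_le ℓ
    (fun a b hab => (hℓ _).trans (hu.Ψ₀_sub_le_varFun hab)) hA

theorem IsBV.ae_apply_density_le (hu : S.IsBV u) {ℓ : X →L[ℝ] ℝ} (hℓ : ℓ ∈ S.Kstar) :
    ∀ᵐ t ∂(S.refMeasure hu), ℓ (S.density hu t) ≤
      ((hu.dVar.restrict (S.jumpSet u)ᶜ).rnDeriv (S.refMeasure hu) t).toReal := by
  have := hu.isFiniteMeasure_refMeasure
  have := hu.isFiniteMeasure_dVar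
  have hJ := hu.measurableSet_jumpSet
  set lam := S.refMeasure hu with hlam
  set m := hu.dVar.restrict (S.jumpSet u)ᶜ with hm
  -- `N` has full reference measure and carries no singular part, so on `A ∩ N` the measure is the
  -- integral of its density.
  obtain ⟨N, hN, hN0, hN1⟩ := m.mutuallySingular_singularPart lam
  refine ae_le_of_forall_setIntegral_le (ℓ.integrable_comp hu.integrable_density)
    Measure.integrable_toReal_rnDeriv fun A hA _ => ?_
  have hA' : MeasurableSet (A ∩ N) := hA.inter hN
  have hae : (A ∩ N : Set ℝ) =ᵐ[lam] A := by
    refine inter_ae_eq_left_of_ae_eq_univ ?_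
    exact ae_eq_univ.2 hN1
  rw [← setIntegral_congr_set hae, ← setIntegral_congr_set hae,
    hu.setIntegral_apply_density ℓ hA', hu.diffuse_apply hA',
    integral_toReal (Measure.measurable_rnDeriv _ _).aemeasurable
      (ae_restrict_of_ae (Measure.rnDeriv_lt_top _ _))]
  have h1 : m (A ∩ N) = ∫⁻ t in A ∩ N, m.rnDeriv lam t ∂lam := by
    conv_lhs => rw [m.haveLebesgueDecomposition_add lam]
    rw [Measure.add_apply, measure_mono_null inter_subset_right hN0, zero_add,
      withDensity_apply _ hA']
  rw [← h1]
  refine (ENNReal.ofReal_le_iff_le_toReal (measure_ne_top _ _)).1 ?_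
  rw [hm, Measure.restrict_apply hA']
  exact hu.apply_derivMeasure_le_dVar hℓ (hA'.diff hJ)

/-- `Ψ₀` is the maximum of the functionals in `K*`. A countable dense family of them allows one
common null set, and the remaining ones follow by continuity. -/
theorem IsBV.ae_Ψ₀_density_le (hu : S.IsBV u) :
    ∀ᵐ t ∂(S.refMeasure hu), S.Ψ₀ (S.density hu t) ≤
      ((hu.dVar.restrict (S.jumpSet u)ᶜ).rnDeriv (S.refMeasure hu) t).toReal := by
  have : Nonempty S.Kstar := ⟨⟨0, zero_mem_Kstar⟩⟩
  have : ProperSpace (X →L[ℝ] ℝ) := FiniteDimensional.proper ℝ _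
  have : SecondCountableTopology (X →L[ℝ] ℝ) := inferInstance
  have h := ae_all_iff.2 fun n : ℕ =>
    hu.ae_apply_density_le (TopologicalSpace.denseSeq S.Kstar n).2
  filter_upwards [h] with t ht
  obtain ⟨ℓ, hℓ, hv⟩ := S.exists_mem_Kstar_apply_eq (S.density hu t)
  rw [← hv]
  refine (TopologicalSpace.denseRange_denseSeq S.Kstar).induction_on
    (p := fun ℓ : S.Kstar => (ℓ : X →L[ℝ] ℝ) (S.density hu t) ≤ _) ⟨ℓ, hℓ⟩ ?_ ht
  refine isClosed_le ?_ continuous_const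
  exact (ContinuousLinearMap.apply ℝ ℝ (S.density hu t)).continuous.comp continuous_subtype_val

theorem IsBV.leftΨ₀_add_rightΨ₀_le (hu : S.IsBV u) {t : ℝ} (ht : t ∈ Icc 0 S.T) :
    S.leftΨ₀ u t + S.rightΨ₀ u t ≤ hu.dVar {t} := by
  have h1 := hu.Ψ₀_sub_left_le t
  have h2 := hu.Ψ₀_right_sub_le t
  rw [ext_apply ht] at h1 h2
  rw [leftΨ₀, rightΨ₀, ← ENNReal.ofReal_add (S.Ψ₀_nonneg _) (S.Ψ₀_nonneg _), dVar,
    StieltjesFunction.measure_singleton, hu.monotone_varFun.stieltjesFunction_eq]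
  have h3 : Function.leftLim hu.monotone_varFun.stieltjesFunction t =
      Function.leftLim (S.varFun u) t :=
    leftLim_rightLim (hu.monotone_varFun.tendsto_leftLim t)
  rw [h3]
  exact ENNReal.ofReal_le_ofReal (by linarith)

/-- Off the jump set the densities are compared; the jump set is countable, so there it suffices to
compare atoms. -/
theorem IsBV.varMeasure_le_dVar (hu : S.IsBV u) {A : Set ℝ} (hA : MeasurableSet A) :
    hu.varMeasure (fun t => S.leftΨ₀ u t + S.rightΨ₀ u t) A ≤ hu.dVar A := by
  have := hu.isFiniteMeasure_refMeasure
  have := hu.isFiniteMeasure_dVar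
  have hJ := hu.measurableSet_jumpSet
  have h1 : hu.dVar A = hu.dVar.restrict (S.jumpSet u)ᶜ A + hu.dVar (S.jumpSet u ∩ A) := by
    rw [Measure.restrict_apply hA, inter_comm _ A, add_comm, ← sdiff_eq,
      measure_inter_add_sdiff A hJ]
  rw [hu.varMeasure_apply _ hA, h1]
  refine add_le_add ?_ ?_
  · refine (lintegral_mono_ae (ae_restrict_of_ae ?_)).trans
      (Measure.setLIntegral_rnDeriv_le (μ := hu.dVar.restrict (S.jumpSet u)ᶜ)
        (ν := S.refMeasure hu) A)
    filter_upwards [hu.ae_Ψ₀_density_le] with t ht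
    exact (ENNReal.ofReal_le_ofReal ht).trans ENNReal.ofReal_toReal_le
  · have h2 := lintegral_countable (μ := hu.dVar) (fun _ => 1)
      (hu.countable_jumpSet.mono (inter_subset_left (t := A)))
    rw [setLIntegral_one] at h2
    rw [h2]
    refine ENNReal.tsum_le_tsum fun s => ?_
    rw [one_mul]
    exact hu.leftΨ₀_add_rightΨ₀_le s.2.1.1

section Superadditive

variable {cl cr : ℝ → ℝ≥0∞} {a b c : ℝ}

theorem IsBV.jumpCostVar_of_lt (hu : S.IsBV u) (h : a < b) :
    hu.jumpCostVar cl cr a b =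
      cr a + hu.varMeasure (fun t => cl t + cr t) (Ioo a b) + cl b := if_pos h

theorem IsBV.jumpCostVar_self (hu : S.IsBV u) : hu.jumpCostVar cl cr a a = 0 :=
  if_neg (lt_irrefl a)

theorem IsBV.varMeasure_singleton_of_mem (hu : S.IsBV u) {t : ℝ} (ht : t ∈ Icc 0 S.T)
    (hl : S.left u t = u t → cl t = 0) (hr : u t = S.right u t → cr t = 0) :
    hu.varMeasure (fun t => cl t + cr t) {t} = cl t + cr t := by
  refine hu.varMeasure_singleton (fun t => cl t + cr t) fun h => ?_
  have h1 : S.left u t = u t := by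
    by_contra h'
    exact h ⟨ht, Or.inl h'⟩
  have h2 : u t = S.right u t := by
    by_contra h'
    exact h ⟨ht, Or.inr h'⟩
  rw [hl h1, hr h2, add_zero]

/-- The measure on the long interval has an atom at `b` only if `b` is a jump time. As the charges
vanish where there is no jump, this atom is always `cl b + cr b`, the sum of the endpoint terms of
the two short intervals. -/
theorem IsBV.jumpCostVar_add (hu : S.IsBV u) (hb : b ∈ Icc 0 S.T) (hab : a ≤ b) (hbc : b ≤ c)
    (hl : S.left u b = u b → cl b = 0) (hr : u b = S.right u b → cr b = 0) :
    hu.jumpCostVar cl cr a b + hu.jumpCostVar cl cr b c = hu.jumpCostVar cl cr a c := by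
  rcases hab.eq_or_lt with rfl | hab
  · rw [hu.jumpCostVar_self, zero_add]
  rcases hbc.eq_or_lt with rfl | hbc
  · rw [hu.jumpCostVar_self, add_zero]
  rw [hu.jumpCostVar_of_lt hab, hu.jumpCostVar_of_lt hbc, hu.jumpCostVar_of_lt (hab.trans hbc)]
  set m := hu.varMeasure fun t => cl t + cr t
  have h1 : m (Ioo a c) = m (Ioo a b) + (cl b + cr b) + m (Ioo b c) := by
    rw [← hu.varMeasure_singleton_of_mem hb hl hr, ← measure_union _ (measurableSet_singleton b),
      Ioo_union_right hab, ← measure_union _ measurableSet_Ioo, Ioc_union_Ioo_eq_Ioo hab.le hbc]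
    · exact disjoint_left.2 fun x hx hx' => not_lt.2 hx.2 hx'.1
    · exact disjoint_singleton_right.2 fun h => lt_irrefl _ h.2
  rw [h1]
  ring

end Superadditive

/-- A functional in `K*` that attains `Ψ₀` at the increment linearizes the claim, and the increment
is the derivative of the open interval plus the two half jumps at its ends. -/
theorem IsBV.ofReal_Ψ₀_sub_le (hu : S.IsBV u) {a b : ℝ} (hab : a < b) :
    ENNReal.ofReal (S.Ψ₀ (u b - u a)) ≤ hu.jumpCostVar (S.leftΨ₀ u) (S.rightΨ₀ u) a b := by
  obtain ⟨ℓ, hℓ, hv⟩ := S.exists_mem_Kstar_apply_eq (u b - u a)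
  rw [hu.jumpCostVar_of_lt hab, ← hv]
  have h : u b - u a = (S.right u a - u a) + hu.derivMeasure (Ioo a b) + (u b - S.left u b) := by
    rw [hu.derivMeasure_Ioo hab]
    abel
  rw [h, map_add, map_add]
  refine ENNReal.ofReal_add_le.trans (add_le_add (ENNReal.ofReal_add_le.trans (add_le_add ?_ ?_)) ?_)
  · exact ENNReal.ofReal_le_ofReal (hℓ _)
  · exact hu.apply_derivMeasure_le hℓ measurableSet_Ioo
  · exact ENNReal.ofReal_le_ofReal (hℓ _)

/-- **Representation of the variation**: the pointwise `Ψ₀`-variation is the sum of the diffuse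
variation and of the `Ψ₀`-sizes of the jumps. -/
theorem IsBV.Var_eq_jumpCostVar (hu : S.IsBV u) {t : ℝ} (ht : t ∈ Icc 0 S.T) :
    S.Var u 0 t = hu.jumpCostVar (S.leftΨ₀ u) (S.rightΨ₀ u) 0 t := by
  rcases ht.1.eq_or_lt with rfl | h0
  · rw [Var_self, hu.jumpCostVar_self]
  refine le_antisymm ?_ ?_
  · refine iSup_le fun M => iSup_le fun τ => iSup_le ?_
    rintro ⟨hτ, hτ0, hτM⟩
    have key : ∀ n ≤ M, ∑ m ∈ Finset.range n, ENNReal.ofReal (S.Ψ₀ (u (τ (m + 1)) - u (τ m))) ≤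
        hu.jumpCostVar (S.leftΨ₀ u) (S.rightΨ₀ u) 0 (τ n) := by
      intro n
      induction n with
      | zero => simp
      | succ n ih =>
        intro hn
        rw [Finset.sum_range_succ]
        refine (add_le_add (ih (Nat.le_of_succ_le hn)) ?_).trans_eq (hu.jumpCostVar_add
          ⟨hτ0 ▸ hτ (Nat.zero_le n), (hτM ▸ hτ (Nat.le_of_succ_le hn)).trans ht.2⟩
          (hτ0 ▸ hτ (Nat.zero_le n)) (hτ (Nat.le_succ n)) leftΨ₀_eq_zero rightΨ₀_eq_zero)
        rcases (hτ (Nat.le_succ n)).eq_or_lt with h | h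
        · rw [← h, sub_self, S.Ψ₀_zero, ENNReal.ofReal_zero]
          exact zero_le
        · exact hu.ofReal_Ψ₀_sub_le h
    rw [← hτM]
    exact key M le_rfl
  · have hV := hu.monotone_varFun
    have h1 := hu.Ψ₀_sub_left_le t
    have h2 := hu.Ψ₀_right_sub_le 0
    rw [ext_apply ht] at h1
    rw [ext_apply (left_mem_Icc.2 S.T_pos.le)] at h2
    have h3 := hu.varMeasure_le_dVar (measurableSet_Ioo (a := 0) (b := t))
    have h4 : Function.leftLim hV.stieltjesFunction t = Function.leftLim (S.varFun u) t :=
      leftLim_rightLim (hV.tendsto_leftLim t)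
    rw [dVar, StieltjesFunction.measure_Ioo, h4, hV.stieltjesFunction_eq] at h3
    have h5 : S.varFun u 0 = 0 := by
      simp [varFun, min_eq_left S.T_pos.le, Var_self]
    have h6 : S.Var u 0 t = ENNReal.ofReal (S.varFun u t) := by
      rw [varFun, min_eq_left ht.2, max_eq_right ht.1, ENNReal.ofReal_toReal (hu.Var_ne_top ht)]
    have h7 := hV.rightLim_le_leftLim h0
    have h8 := hV.leftLim_le (le_refl t)
    have h9 := hV.le_rightLim (le_refl (0 : ℝ))
    -- The open interval has Stieltjes measure equal to the left limit at `t` minus the right limit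
    -- at `0`. With the bounds for the two end jumps the sum telescopes to `S.varFun u t`.
    rw [hu.jumpCostVar_of_lt h0, h6]
    refine (add_le_add (add_le_add (ENNReal.ofReal_le_ofReal h2) h3)
      (ENNReal.ofReal_le_ofReal h1)).trans ?_
    rw [← ENNReal.ofReal_add (by linarith) (by linarith),
      ← ENNReal.ofReal_add (by linarith) (by linarith)]
    exact ENNReal.ofReal_le_ofReal (by linarith)

end RISystem

/-! ### Energy balances localized at jump times. -/

namespace RISystem

variable {X : Type*} [NormedAddCommGroup X] [NormedSpace ℝ X] {S : RISystem X} {u : ℝ → X}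

variable [FiniteDimensional ℝ X]

theorem IsBV.measurable_ext [MeasurableSpace X] [BorelSpace X] (hu : S.IsBV u) :
    Measurable (S.ext u) := by
  refine measurable_of_countable_not_continuousAt
    (Set.Countable.mono ?_ hu.monotone_varFun.countable_not_continuousAt)
  intro t ht hc
  refine ht ?_
  have h1 := hu.monotone_varFun.continuousAt_iff_leftLim_eq_rightLim.1 hc
  have h2 := hu.monotone_varFun.leftLim_le (le_refl t)
  have h3 := hu.monotone_varFun.le_rightLim (le_refl t)
  have h4 := eq_of_Ψ₀_sub_le_zero ((hu.Ψ₀_sub_left_le t).trans (by linarith))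
  have h5 := eq_of_Ψ₀_sub_le_zero ((hu.Ψ₀_right_sub_le t).trans (by linarith))
  rw [continuousAt_iff_continuous_left'_right', ContinuousWithinAt, ContinuousWithinAt]
  exact ⟨by simpa [h4] using hu.tendsto_left t, by simpa [← h5] using hu.tendsto_right t⟩

theorem IsBV.integrableOn_dtE (hu : S.IsBV u) :
    IntegrableOn (fun s => S.dtE s (u s)) (Icc 0 S.T) := by
  borelize X
  -- Clamping the time makes `∂_t E` continuous on the whole space, so it can be composed with the
  -- measurable extension of `u`.
  have hF : Continuous fun q : ℝ × X => S.dtE (max 0 (min q.1 S.T)) q.2 :=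
    S.continuousOn_dtE.comp_continuous (f := fun q : ℝ × X => (max 0 (min q.1 S.T), q.2))
      (by fun_prop) fun q => ⟨clamp_mem q.1, mem_univ _⟩
  have hm : Measurable fun s => S.dtE (max 0 (min s S.T)) (S.ext u s) :=
    hF.measurable.comp (measurable_id.prodMk hu.measurable_ext)
  have hK : IsCompact (Icc 0 S.T ×ˢ Metric.closedBall (u 0) (eVariationOn u (Icc 0 S.T)).toReal) :=
    isCompact_Icc.prod (isCompact_closedBall _ _)
  obtain ⟨C, hC⟩ := hK.exists_bound_of_continuousOn hF.continuousOn
  have h0 : IntegrableOn (fun s => S.dtE (max 0 (min s S.T)) (S.ext u s)) (Icc 0 S.T) := by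
    refine Measure.integrableOn_of_bounded (M := C) measure_Icc_lt_top.ne hm.aestronglyMeasurable ?_
    refine (ae_restrict_iff' measurableSet_Icc).2 (Eventually.of_forall fun s hs => ?_)
    refine hC (s, S.ext u s) ⟨hs, ?_⟩
    rw [ext_apply hs]
    exact BoundedVariationOn.dist_le hu hs (left_mem_Icc.2 S.T_pos.le)
  refine h0.congr_fun (fun s hs => ?_) measurableSet_Icc
  simp only [ext_apply hs, min_eq_left hs.2, max_eq_right hs.1]

theorem IsBV.continuousOn_work (hu : S.IsBV u) : ContinuousOn (S.work u) (Icc 0 S.T) := by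
  have h := hu.integrableOn_dtE
  rw [← uIcc_of_le S.T_pos.le] at h ⊢
  exact intervalIntegral.continuousOn_primitive_interval h

/-- The energy balance for a variation with jump contributions `cl` and `cr`. -/
def JumpCostBalance (hu : S.IsBV u) (cl cr : ℝ → ℝ≥0∞) : Prop :=
  ∀ t ∈ Icc 0 S.T, ((S.E t (u t) : ℝ) : EReal) + (hu.jumpCostVar cl cr 0 t : EReal) =
    ((S.E 0 (u 0) + S.work u t : ℝ) : EReal)

section Balance

variable {hu : S.IsBV u} {cl cr : ℝ → ℝ≥0∞}

theorem JumpCostBalance.ne_top (h : JumpCostBalance hu cl cr) {t : ℝ} (ht : t ∈ Icc 0 S.T) :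
    hu.jumpCostVar cl cr 0 t ≠ ∞ := by
  intro h'
  have := h t ht
  rw [h', EReal.coe_ennreal_top, EReal.coe_add_top] at this
  exact EReal.coe_ne_top _ this.symm

theorem JumpCostBalance.toReal_eq (h : JumpCostBalance hu cl cr) {t : ℝ} (ht : t ∈ Icc 0 S.T) :
    (hu.jumpCostVar cl cr 0 t).toReal = S.E 0 (u 0) + S.work u t - S.E t (u t) := by
  have h1 := h t ht
  rw [← ENNReal.ofReal_toReal (h.ne_top ht), EReal.coe_ennreal_ofReal,
    max_eq_left ENNReal.toReal_nonneg, ← EReal.coe_add, EReal.coe_eq_coe_iff] at h1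
  linarith

/-- Additivity of the variation turns the balances on `[0,a]` and `[0,b]` into one on `[a,b]`. -/
theorem JumpCostBalance.toReal_jumpCostVar (h : JumpCostBalance hu cl cr)
    (hl : ∀ t ∈ Icc 0 S.T, S.left u t = u t → cl t = 0)
    (hr : ∀ t ∈ Icc 0 S.T, u t = S.right u t → cr t = 0)
    {a b : ℝ} (ha : a ∈ Icc 0 S.T) (hb : b ∈ Icc 0 S.T) (hab : a ≤ b) :
    hu.jumpCostVar cl cr a b ≠ ∞ ∧ (hu.jumpCostVar cl cr a b).toReal =
      S.work u b - S.E b (u b) - (S.work u a - S.E a (u a)) := by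
  have h1 := hu.jumpCostVar_add ha ha.1 hab (hl a ha) (hr a ha)
  have h2 : hu.jumpCostVar cl cr a b ≠ ∞ :=
    ne_top_of_le_ne_top (h.ne_top hb) (h1 ▸ le_add_self)
  refine ⟨h2, ?_⟩
  have h3 := congrArg ENNReal.toReal h1
  rw [ENNReal.toReal_add (h.ne_top ha) h2, h.toReal_eq ha, h.toReal_eq hb] at h3
  linarith

theorem JumpCostBalance.measure_Ioo_ne_top (h : JumpCostBalance hu cl cr) :
    hu.varMeasure (fun t => cl t + cr t) (Ioo 0 S.T) ≠ ∞ := by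
  have h1 := h.ne_top (right_mem_Icc.2 S.T_pos.le)
  rw [hu.jumpCostVar_of_lt S.T_pos] at h1
  exact ne_top_of_le_ne_top h1 (le_add_right le_add_self)

/-- Energy drop of a solution on the left of a time `t`. -/
theorem JumpCostBalance.left (h : JumpCostBalance hu cl cr)
    (hl : ∀ t ∈ Icc 0 S.T, S.left u t = u t → cl t = 0)
    (hr : ∀ t ∈ Icc 0 S.T, u t = S.right u t → cr t = 0) {t : ℝ} (ht : t ∈ Icc 0 S.T) :
    cl t ≠ ∞ ∧ S.E t (S.left u t) - S.E t (u t) = (cl t).toReal := by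
  rcases ht.1.eq_or_lt with rfl | h0
  · rw [left_zero, hl 0 ht left_zero]
    simp
  obtain ⟨s, hs, hst, hlim⟩ := exists_seq_strictMono_tendsto' h0
  have hsm : ∀ n, s n ∈ Icc 0 S.T := fun n => ⟨(hst n).1.le, (hst n).2.le.trans ht.2⟩
  have hq := fun n => h.toReal_jumpCostVar hl hr (hsm n) ht (hst n).2.le
  set m := hu.varMeasure fun t => cl t + cr t with hm
  have hQ : ∀ n, hu.jumpCostVar cl cr (s n) t = cr (s n) + m (Ioo (s n) t) + cl t := fun n =>
    hu.jumpCostVar_of_lt (hst n).2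
  have hcl : cl t ≠ ∞ := ne_top_of_le_ne_top (hq 0).1 (hQ 0 ▸ le_add_self)
  refine ⟨hcl, ?_⟩
  -- The left endpoint is included so that its atom absorbs the term `cr (s n)`.
  have hm0 : Tendsto (fun n => m (Ico (s n) t)) atTop (𝓝 0) := by
    have h1 : ⋂ n, Ico (s n) t = ∅ := by
      refine eq_empty_of_forall_notMem fun x hx => ?_
      have hx' := fun n => mem_iInter.1 hx n
      exact absurd (le_of_tendsto hlim (Eventually.of_forall fun n => (hx' n).1))
        (not_le.2 (hx' 0).2)
    have h2 := tendsto_measure_iInter_atTop (μ := m) (s := fun n => Ico (s n) t)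
      (fun n => measurableSet_Ico.nullMeasurableSet)
      (fun i j hij => Ico_subset_Ico_left (hs.monotone hij))
      ⟨0, ne_top_of_le_ne_top h.measure_Ioo_ne_top (measure_mono fun x hx =>
        ⟨(hst 0).1.trans_le hx.1, hx.2.trans_le ht.2⟩)⟩
    rw [h1, measure_empty] at h2
    exact h2
  have hlim1 : Tendsto (fun n => hu.jumpCostVar cl cr (s n) t) atTop (𝓝 (cl t)) := by
    refine tendsto_of_tendsto_of_tendsto_of_le_of_le tendsto_const_nhds
      (by simpa using hm0.add_const (cl t)) (fun n => hQ n ▸ le_add_self) fun n => ?_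
    simp only
    rw [hQ n]
    refine add_le_add_left ?_ _
    rw [← Ioo_union_left (hst n).2, measure_union
      (disjoint_singleton_right.2 fun h => lt_irrefl _ h.1) (measurableSet_singleton _),
      hu.varMeasure_singleton_of_mem (hsm n) (hl _ (hsm n)) (hr _ (hsm n)), add_comm]
    exact add_le_add_right le_add_self _
  have hlim2 := (ENNReal.tendsto_toReal hcl).comp hlim1
  have hlimt : Tendsto s atTop (𝓝[Icc 0 S.T] t) :=
    tendsto_nhdsWithin_iff.2 ⟨hlim, Eventually.of_forall hsm⟩
  have hlimu : Tendsto (fun n => u (s n)) atTop (𝓝 (S.left u t)) :=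
    ((hu.tendsto_left t).comp (tendsto_nhdsWithin_iff.2
      ⟨hlim, Eventually.of_forall fun n => (hst n).2⟩)).congr fun n => ext_apply (hsm n)
  have hlimE : Tendsto (fun n => S.E (s n) (u (s n))) atTop (𝓝 (S.E t (S.left u t))) :=
    (S.continuousOn_E (t, S.left u t) ⟨ht, mem_univ _⟩).tendsto.comp
      (tendsto_nhdsWithin_iff.2 ⟨hlim.prodMk_nhds hlimu,
        Eventually.of_forall fun n => ⟨hsm n, mem_univ _⟩⟩)
  have hlimw := (hu.continuousOn_work t ht).tendsto.comp hlimt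
  have hlim3 : Tendsto (fun n => (hu.jumpCostVar cl cr (s n) t).toReal) atTop
      (𝓝 (S.work u t - S.E t (u t) - (S.work u t - S.E t (S.left u t)))) := by
    simp only [(hq _).2]
    exact tendsto_const_nhds.sub (hlimw.sub hlimE)
  have := tendsto_nhds_unique hlim2 hlim3
  linarith

/-- Energy drop of a solution on the right of a time `t`. -/
theorem JumpCostBalance.right (h : JumpCostBalance hu cl cr)
    (hl : ∀ t ∈ Icc 0 S.T, S.left u t = u t → cl t = 0)
    (hr : ∀ t ∈ Icc 0 S.T, u t = S.right u t → cr t = 0) {t : ℝ} (ht : t ∈ Icc 0 S.T) :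
    cr t ≠ ∞ ∧ S.E t (u t) - S.E t (S.right u t) = (cr t).toReal := by
  rcases ht.2.eq_or_lt with rfl | h0
  · rw [right_T, hr S.T ht right_T.symm]
    simp
  obtain ⟨s, hs, hst, hlim⟩ := exists_seq_strictAnti_tendsto' h0
  have hsm : ∀ n, s n ∈ Icc 0 S.T := fun n => ⟨ht.1.trans (hst n).1.le, (hst n).2.le⟩
  have hq := fun n => h.toReal_jumpCostVar hl hr ht (hsm n) (hst n).1.le
  set m := hu.varMeasure fun t => cl t + cr t with hm
  have hQ : ∀ n, hu.jumpCostVar cl cr t (s n) = cr t + m (Ioo t (s n)) + cl (s n) := fun n =>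
    hu.jumpCostVar_of_lt (hst n).1
  have hle : ∀ n, cr t ≤ hu.jumpCostVar cl cr t (s n) := fun n => by
    rw [hQ n, add_assoc]
    exact le_self_add
  have hcr : cr t ≠ ∞ := ne_top_of_le_ne_top (hq 0).1 (hle 0)
  refine ⟨hcr, ?_⟩
  -- The right endpoint is included so that its atom absorbs the term `cl (s n)`.
  have hm0 : Tendsto (fun n => m (Ioc t (s n))) atTop (𝓝 0) := by
    have h1 : ⋂ n, Ioc t (s n) = ∅ := by
      refine eq_empty_of_forall_notMem fun x hx => ?_
      have hx' := fun n => mem_iInter.1 hx n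
      exact absurd (ge_of_tendsto hlim (Eventually.of_forall fun n => (hx' n).2))
        (not_le.2 (hx' 0).1)
    have h2 := tendsto_measure_iInter_atTop (μ := m) (s := fun n => Ioc t (s n))
      (fun n => measurableSet_Ioc.nullMeasurableSet)
      (fun i j hij => Ioc_subset_Ioc_right (hs.antitone hij))
      ⟨0, ne_top_of_le_ne_top h.measure_Ioo_ne_top (measure_mono fun x hx =>
        ⟨ht.1.trans_lt hx.1, hx.2.trans_lt (hst 0).2⟩)⟩
    rw [h1, measure_empty] at h2
    exact h2
  have hlim1 : Tendsto (fun n => hu.jumpCostVar cl cr t (s n)) atTop (𝓝 (cr t)) := by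
    refine tendsto_of_tendsto_of_tendsto_of_le_of_le tendsto_const_nhds
      (by simpa using hm0.const_add (cr t)) hle fun n => ?_
    simp only
    rw [hQ n, add_assoc]
    refine add_le_add_right ?_ _
    rw [← Ioo_union_right (hst n).1, measure_union
      (disjoint_singleton_right.2 fun h => lt_irrefl _ h.2) (measurableSet_singleton _),
      hu.varMeasure_singleton_of_mem (hsm n) (hl _ (hsm n)) (hr _ (hsm n))]
    exact add_le_add_right le_self_add _
  have hlim2 := (ENNReal.tendsto_toReal hcr).comp hlim1
  have hlimt : Tendsto s atTop (𝓝[Icc 0 S.T] t) :=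
    tendsto_nhdsWithin_iff.2 ⟨hlim, Eventually.of_forall hsm⟩
  have hlimu : Tendsto (fun n => u (s n)) atTop (𝓝 (S.right u t)) :=
    ((hu.tendsto_right t).comp (tendsto_nhdsWithin_iff.2
      ⟨hlim, Eventually.of_forall fun n => (hst n).1⟩)).congr fun n => ext_apply (hsm n)
  have hlimE : Tendsto (fun n => S.E (s n) (u (s n))) atTop (𝓝 (S.E t (S.right u t))) :=
    (S.continuousOn_E (t, S.right u t) ⟨ht, mem_univ _⟩).tendsto.comp
      (tendsto_nhdsWithin_iff.2 ⟨hlim.prodMk_nhds hlimu,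
        Eventually.of_forall fun n => ⟨hsm n, mem_univ _⟩⟩)
  have hlimw := (hu.continuousOn_work t ht).tendsto.comp hlimt
  have hlim3 : Tendsto (fun n => (hu.jumpCostVar cl cr t (s n)).toReal) atTop
      (𝓝 (S.work u t - S.E t (S.right u t) - (S.work u t - S.E t (u t)))) := by
    simp only [(hq _).2]
    exact (hlimw.sub hlimE).sub tendsto_const_nhds
  have := tendsto_nhds_unique hlim2 hlim3
  linarith

/-- Two jump contributions that agree at the jump times define the same variation on `[0,t]`. -/
theorem IsBV.jumpCostVar_congr (hu : S.IsBV u) {cl cr cl' cr' : ℝ → ℝ≥0∞}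
    (hl : ∀ t ∈ Icc 0 S.T, cl t = cl' t) (hr : ∀ t ∈ Icc 0 S.T, cr t = cr' t) {t : ℝ}
    (ht : t ∈ Icc 0 S.T) : hu.jumpCostVar cl cr 0 t = hu.jumpCostVar cl' cr' 0 t := by
  unfold jumpCostVar
  rw [hl t ht, hr 0 (left_mem_Icc.2 S.T_pos.le), hu.varMeasure_apply _ measurableSet_Ioo,
    hu.varMeasure_apply _ measurableSet_Ioo]
  have h : ∑' s : ↥(S.jumpSet u ∩ Ioo 0 t), (cl s + cr s) =
      ∑' s : ↥(S.jumpSet u ∩ Ioo 0 t), (cl' s + cr' s) :=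
    tsum_congr fun s => by rw [hl s s.2.1.1, hr s s.2.1.1]
  rw [h]

end Balance

end RISystem

/-! ### Comparison of BV and energetic solutions. -/

theorem ENNReal.eq_and_eq_of_add_le {a b c d : ℝ≥0∞} (hac : a ≤ c) (hbd : b ≤ d)
    (h : c + d ≤ a + b) (ha : a ≠ ∞) (hb : b ≠ ∞) : c = a ∧ d = b := by
  have hcd : c + d ≠ ∞ := ne_top_of_le_ne_top (ENNReal.add_ne_top.2 ⟨ha, hb⟩) h
  rw [ENNReal.add_ne_top] at hcd
  refine ⟨le_antisymm ?_ hac, le_antisymm ?_ hbd⟩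
  · exact ENNReal.le_of_add_le_add_right hcd.2 (h.trans (by gcongr))
  · exact ENNReal.le_of_add_le_add_left hcd.1 (h.trans (by gcongr))

theorem EReal.coe_eq_coe_ennreal_iff {x : ℝ} {a : ℝ≥0∞} :
    (x : EReal) = (a : EReal) ↔ a ≠ ∞ ∧ x = a.toReal := by
  constructor
  · intro h
    have ha : a ≠ ∞ := by
      rintro rfl
      exact EReal.coe_ne_top _ h
    refine ⟨ha, ?_⟩
    rw [← ENNReal.ofReal_toReal ha, EReal.coe_ennreal_ofReal, max_eq_left ENNReal.toReal_nonneg,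
      EReal.coe_eq_coe_iff] at h
    exact h
  · rintro ⟨ha, rfl⟩
    rw [← ENNReal.ofReal_toReal ha, EReal.coe_ennreal_ofReal, max_eq_left ENNReal.toReal_nonneg,
      ENNReal.ofReal_toReal ha]

namespace RISystem

variable {X : Type*} [NormedAddCommGroup X] [NormedSpace ℝ X] {S : RISystem X} {u : ℝ → X}

theorem left_eq_of_notMem {t : ℝ} (ht : t ∈ Icc 0 S.T) (h : t ∉ S.jumpSet u) :
    S.left u t = u t := by
  by_contra h'
  exact h ⟨ht, Or.inl h'⟩

theorem right_eq_of_notMem {t : ℝ} (ht : t ∈ Icc 0 S.T) (h : t ∉ S.jumpSet u) :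
    S.right u t = u t := by
  by_contra h'
  exact h ⟨ht, Or.inr (Ne.symm h')⟩

/-- Stability is tested at `u t + r • z` and divided by `r ↓ 0`. -/
theorem GloballyStable.neg_DE_mem_Kstar (h : S.GloballyStable u) {t : ℝ} (ht : t ∈ Icc 0 S.T) :
    -S.DE t (u t) ∈ S.Kstar := by
  intro z
  have h1 : HasDerivAt (fun r : ℝ => S.E t (u t + r • z)) (S.DE t (u t) z) 0 := by
    have h2 : HasDerivAt (fun r : ℝ => u t + r • z) z 0 := by
      simpa using ((hasDerivAt_id (0 : ℝ)).smul_const z).const_add (u t)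
    have h3 : HasFDerivAt (S.E t) (S.DE t (u t)) (u t + (0 : ℝ) • z) := by
      rw [zero_smul, add_zero]
      exact ((contDiff_E ht).differentiable one_ne_zero (u t)).hasFDerivAt
    exact h3.comp_hasDerivAt 0 h2
  have h4 : -S.Ψ₀ z ≤ S.DE t (u t) z := by
    refine ge_of_tendsto h1.tendsto_slope_zero_right ?_
    filter_upwards [self_mem_nhdsWithin] with r (hr : 0 < r)
    have h5 := h t ht (u t + r • z)
    rw [add_sub_cancel_left, S.Ψ₀_smul r z hr.le] at h5
    rw [zero_add, zero_smul, add_zero, smul_eq_mul, le_inv_mul_iff₀ hr]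
    linarith
  rw [_root_.neg_apply]
  linarith

variable [FiniteDimensional ℝ X]

/-- Global stability passes to the left limits. -/
theorem GloballyStable.left (h : S.GloballyStable u) (hu : S.IsBV u) {t : ℝ}
    (ht : t ∈ Icc 0 S.T) (z : X) :
    S.E t (S.left u t) ≤ S.E t z + S.Ψ₀ (z - S.left u t) := by
  rcases ht.1.eq_or_lt with rfl | h0
  · rw [left_zero]
    exact h 0 ht z
  have hmem : ∀ᶠ s in 𝓝[<] t, s ∈ Icc 0 S.T := by
    filter_upwards [self_mem_nhdsWithin, mem_nhdsWithin_of_mem_nhds (Ioi_mem_nhds h0)] with s h1 h2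
    exact ⟨le_of_lt h2, (le_of_lt h1).trans ht.2⟩
  have hE : ∀ {v : ℝ → X} {x : X}, Tendsto v (𝓝[<] t) (𝓝 x) →
      Tendsto (fun s => S.E s (v s)) (𝓝[<] t) (𝓝 (S.E t x)) := fun {v x} hv =>
    (S.continuousOn_E (t, x) ⟨ht, mem_univ _⟩).tendsto.comp (tendsto_nhdsWithin_iff.2
      ⟨(tendsto_id.mono_right nhdsWithin_le_nhds).prodMk_nhds hv,
        hmem.mono fun s hs => ⟨hs, mem_univ _⟩⟩)
  have hlim := hu.tendsto_left t
  refine le_of_tendsto_of_tendsto (hE hlim) ((hE tendsto_const_nhds).add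
    ((S.continuous_Ψ₀.tendsto _).comp (tendsto_const_nhds.sub hlim))) ?_
  filter_upwards [hmem] with s hs
  rw [ext_apply hs]
  simpa [ext_apply hs] using h s hs z

/-- Energetic type depends only on the endpoints. For `a ≠ b` an optimal transition exists, so the
condition is not vacuous; for `a = b` the cost is zero. -/
theorem transitionsEnergetic_iff {t : ℝ} (ht : t ∈ Icc 0 S.T) {a b : X}
    (h : S.cost t a b ≠ ∞ ∧ S.E t a - S.E t b = (S.cost t a b).toReal) :
    S.TransitionsEnergetic t a b ↔ S.cost t a b = ENNReal.ofReal (S.Ψ₀ (b - a)) := by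
  constructor
  · intro hT
    by_cases hab : a = b
    · rw [hab, S.cost_self, sub_self, S.Ψ₀_zero, ENNReal.ofReal_zero]
    · obtain ⟨r₀, r₁, ϑ, hϑ⟩ :=
        exists_isOptimalTransition ht hab (EReal.coe_eq_coe_ennreal_iff.2 h)
      have h1 : S.E t b - S.E t a = -S.Ψ₀ (b - a) := hT r₀ r₁ ϑ hϑ
      rw [← ENNReal.ofReal_toReal h.1, ← h.2]
      congr 1
      linarith
  · intro hc _ _ _ _
    rw [hc, ENNReal.toReal_ofReal (S.Ψ₀_nonneg _)] at h
    change S.E t b - S.E t a = -S.Ψ₀ (b - a)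
    linarith [h.2]

theorem energyBalance_iff (hu : S.IsBV u) :
    S.EnergyBalance u ↔ JumpCostBalance hu (S.leftΨ₀ u) (S.rightΨ₀ u) :=
  forall₂_congr fun t ht => by rw [hu.Var_eq_jumpCostVar ht]

theorem pEnergyBalance_iff (hu : S.IsBV u) :
    S.PEnergyBalance hu ↔ JumpCostBalance hu (fun t => S.cost t (S.left u t) (u t))
      (fun t => S.cost t (u t) (S.right u t)) :=
  forall₂_congr fun t _ => by rw [hu.pVar_eq]

theorem PEnergyBalance.left {hu : S.IsBV u} (h : S.PEnergyBalance hu) {t : ℝ}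
    (ht : t ∈ Icc 0 S.T) : S.cost t (S.left u t) (u t) ≠ ∞ ∧
      S.E t (S.left u t) - S.E t (u t) = (S.cost t (S.left u t) (u t)).toReal :=
  ((pEnergyBalance_iff hu).1 h).left (fun t _ h => by rw [h, S.cost_self])
    (fun t _ h => by rw [← h, S.cost_self]) ht

theorem PEnergyBalance.right {hu : S.IsBV u} (h : S.PEnergyBalance hu) {t : ℝ}
    (ht : t ∈ Icc 0 S.T) : S.cost t (u t) (S.right u t) ≠ ∞ ∧
      S.E t (u t) - S.E t (S.right u t) = (S.cost t (u t) (S.right u t)).toReal :=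
  ((pEnergyBalance_iff hu).1 h).right (fun t _ h => by rw [h, S.cost_self])
    (fun t _ h => by rw [← h, S.cost_self]) ht

theorem EnergyBalance.left (h : S.EnergyBalance u) (hu : S.IsBV u) {t : ℝ}
    (ht : t ∈ Icc 0 S.T) : S.E t (S.left u t) - S.E t (u t) = S.Ψ₀ (u t - S.left u t) := by
  rw [(((energyBalance_iff hu).1 h).left (fun _ _ => leftΨ₀_eq_zero)
    (fun _ _ => rightΨ₀_eq_zero) ht).2, leftΨ₀, ENNReal.toReal_ofReal (S.Ψ₀_nonneg _)]

theorem EnergyBalance.right (h : S.EnergyBalance u) (hu : S.IsBV u) {t : ℝ}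
    (ht : t ∈ Icc 0 S.T) : S.E t (u t) - S.E t (S.right u t) = S.Ψ₀ (S.right u t - u t) := by
  rw [(((energyBalance_iff hu).1 h).right (fun _ _ => leftΨ₀_eq_zero)
    (fun _ _ => rightΨ₀_eq_zero) ht).2, rightΨ₀, ENNReal.toReal_ofReal (S.Ψ₀_nonneg _)]

/-- The transition costs at the jumps of `u` reduce to the `Ψ₀`-sizes of the jumps. -/
def JumpsEnergetic (S : RISystem X) (u : ℝ → X) : Prop :=
  ∀ t ∈ S.jumpSet u, S.cost t (S.left u t) (u t) = S.leftΨ₀ u t ∧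
    S.cost t (u t) (S.right u t) = S.rightΨ₀ u t

/-- Off the jump set both charges vanish, so agreement at the jump times makes the two variations
equal. -/
theorem JumpsEnergetic.energyBalance_iff_pEnergyBalance (h : S.JumpsEnergetic u) (hu : S.IsBV u) :
    S.EnergyBalance u ↔ S.PEnergyBalance hu := by
  have h1 : ∀ t ∈ Icc 0 S.T, S.leftΨ₀ u t = S.cost t (S.left u t) (u t) ∧
      S.rightΨ₀ u t = S.cost t (u t) (S.right u t) := by
    intro t ht
    by_cases hJ : t ∈ S.jumpSet u
    · exact ⟨(h t hJ).1.symm, (h t hJ).2.symm⟩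
    · have hl := left_eq_of_notMem ht hJ
      have hr := right_eq_of_notMem ht hJ
      rw [leftΨ₀_eq_zero hl, rightΨ₀_eq_zero hr.symm, hl, hr, S.cost_self]
      exact ⟨rfl, rfl⟩
  rw [energyBalance_iff hu, pEnergyBalance_iff]
  refine forall₂_congr fun t ht => ?_
  rw [hu.jumpCostVar_congr (fun t ht => (h1 t ht).1) (fun t ht => (h1 t ht).2) ht]

/-- If both balances hold, each half jump releases an energy equal to its cost and also to its
`Ψ₀`-size. -/
theorem PEnergyBalance.energyBalance_iff {hu : S.IsBV u} (h : S.PEnergyBalance hu) :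
    S.EnergyBalance u ↔ S.JumpsEnergetic u := by
  refine ⟨fun hE t hJ => ?_, fun hJ => (hJ.energyBalance_iff_pEnergyBalance hu).2 h⟩
  have hl := h.left hJ.1
  have hr := h.right hJ.1
  rw [hE.left hu hJ.1] at hl
  rw [hE.right hu hJ.1] at hr
  rw [leftΨ₀, rightΨ₀, hl.2, hr.2, ENNReal.ofReal_toReal hl.1, ENNReal.ofReal_toReal hr.1]
  exact ⟨rfl, rfl⟩

theorem PEnergyBalance.jumpsEnergetic_iff {hu : S.IsBV u} (h : S.PEnergyBalance hu) :
    S.JumpsEnergetic u ↔ ∀ t ∈ S.jumpSet u, S.TransitionsEnergetic t (S.left u t) (u t) ∧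
      S.TransitionsEnergetic t (u t) (S.right u t) :=
  forall₂_congr fun t hJ => by
    rw [transitionsEnergetic_iff hJ.1 (h.left hJ.1), transitionsEnergetic_iff hJ.1 (h.right hJ.1)]
    rfl

/-- For a solution, the cost of a jump is the sum of those of its two halves. -/
theorem PEnergyBalance.cost_left_right {hu : S.IsBV u} (h : S.PEnergyBalance hu) {t : ℝ}
    (ht : t ∈ Icc 0 S.T) : S.cost t (S.left u t) (S.right u t) =
      S.cost t (S.left u t) (u t) + S.cost t (u t) (S.right u t) := by
  refine le_antisymm (cost_triangle ht _ _ _) ?_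
  -- The energies released in the halves add up to that of the whole jump, which is at most its
  -- cost.
  refine le_trans (le_of_eq ?_) (ofReal_energy_le_cost ht _ _)
  rw [← sub_add_sub_cancel _ (S.E t (u t)), (h.left ht).2, (h.right ht).2,
    ENNReal.ofReal_add ENNReal.toReal_nonneg ENNReal.toReal_nonneg,
    ENNReal.ofReal_toReal (h.left ht).1, ENNReal.ofReal_toReal (h.right ht).1]

theorem PEnergyBalance.left_right {hu : S.IsBV u} (h : S.PEnergyBalance hu) {t : ℝ}
    (ht : t ∈ Icc 0 S.T) : S.cost t (S.left u t) (S.right u t) ≠ ∞ ∧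
      S.E t (S.left u t) - S.E t (S.right u t) =
        (S.cost t (S.left u t) (S.right u t)).toReal := by
  rw [h.cost_left_right ht]
  refine ⟨ENNReal.add_ne_top.2 ⟨(h.left ht).1, (h.right ht).1⟩, ?_⟩
  rw [ENNReal.toReal_add (h.left ht).1 (h.right ht).1, ← (h.left ht).2, ← (h.right ht).2]
  ring

/-- The half costs add up to the cost of the whole jump, which is its `Ψ₀`-size and by subadditivity
at most the sum of the `Ψ₀`-sizes of the halves. Each half cost being at least its `Ψ₀`-size, both
are equalities. -/
theorem PEnergyBalance.jumpsEnergetic_of_transitionsEnergetic {hu : S.IsBV u}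
    (h : S.PEnergyBalance hu)
    (hT : ∀ t ∈ S.jumpSet u, S.TransitionsEnergetic t (S.left u t) (S.right u t)) :
    S.JumpsEnergetic u := by
  intro t hJ
  refine ENNReal.eq_and_eq_of_add_le (S.ofReal_Ψ₀_le_cost t _ _) (S.ofReal_Ψ₀_le_cost t _ _) ?_
    ENNReal.ofReal_ne_top ENNReal.ofReal_ne_top
  rw [← h.cost_left_right hJ.1, (transitionsEnergetic_iff hJ.1 (h.left_right hJ.1)).1 (hT t hJ),
    ← sub_add_sub_cancel' (u t) (S.left u t), leftΨ₀, rightΨ₀,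
    ← ENNReal.ofReal_add (S.Ψ₀_nonneg _) (S.Ψ₀_nonneg _)]
  exact ENNReal.ofReal_le_ofReal (S.Ψ₀_add_le _ _)

theorem cost_eq_of_energy_le {t : ℝ} {a b : X}
    (h : S.cost t a b ≠ ∞ ∧ S.E t a - S.E t b = (S.cost t a b).toReal)
    (hle : S.E t a ≤ S.E t b + S.Ψ₀ (b - a)) :
    S.cost t a b = ENNReal.ofReal (S.Ψ₀ (b - a)) := by
  refine le_antisymm ?_ (S.ofReal_Ψ₀_le_cost t a b)
  rw [← ENNReal.ofReal_toReal h.1, ← h.2]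
  exact ENNReal.ofReal_le_ofReal (by linarith)

theorem PEnergyBalance.jumpsEnergetic {hu : S.IsBV u} (h : S.PEnergyBalance hu)
    (hS : S.GloballyStable u) : S.JumpsEnergetic u := fun t hJ =>
  ⟨cost_eq_of_energy_le (h.left hJ.1) (hS.left hu hJ.1 _),
    cost_eq_of_energy_le (h.right hJ.1) (hS t hJ.1 _)⟩

/-- Minimizing curves for the two halves, joined at `u(t)`, have the released energy as total
duration. Stability of the left limit bounds this by the `Ψ₀`-size of the whole jump, which forces
sliding. -/
theorem PEnergyBalance.exists_isSliding {hu : S.IsBV u} (h : S.PEnergyBalance hu)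
    (hS : S.GloballyStable u) {t : ℝ} (hJ : t ∈ S.jumpSet u) :
    ∃ (r₀ r₁ : EReal) (ϑ : EReal → X),
      S.IsOptimalTransition t (S.left u t) (S.right u t) r₀ r₁ ϑ ∧
      S.IsSliding t r₀ r₁ ϑ ∧ ∃ r ∈ Icc r₀ r₁, ϑ r = u t := by
  have ht := hJ.1
  obtain ⟨hl, hlE⟩ := h.left ht
  obtain ⟨hr, hrE⟩ := h.right ht
  obtain ⟨hlr, hlrE⟩ := h.left_right ht
  set L₁ := (S.cost t (S.left u t) (u t)).toReal with hL₁
  set L₂ := (S.cost t (u t) (S.right u t)).toReal with hL₂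
  have h1 : 0 ≤ L₁ := ENNReal.toReal_nonneg
  have h2 : 0 ≤ L₂ := ENNReal.toReal_nonneg
  obtain ⟨ζ₁, hζ₁, hζ₁0, hζ₁L⟩ := exists_isSlowCurve_cost ht h1 (ENNReal.ofReal_toReal hl).ge
  obtain ⟨ζ₂, hζ₂, hζ₂0, hζ₂L⟩ := exists_isSlowCurve_cost ht h2 (ENNReal.ofReal_toReal hr).ge
  have hζ := hζ₁.concat hζ₂ (hζ₁L.trans hζ₂0.symm)
  set ζ : ℝ → X := fun r => if r ≤ L₁ then ζ₁ r else ζ₂ (r - L₁) with hζdef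
  have hζ0 : ζ 0 = S.left u t := by simp [hζdef, h1, hζ₁0]
  have hζm : ζ L₁ = u t := by simp [hζdef, hζ₁L]
  have hζL : ζ (L₁ + L₂) = S.right u t := by
    by_cases h0 : L₁ + L₂ ≤ L₁
    · have h3 : L₂ = 0 := by linarith
      rw [h3, add_zero, hζm, ← hζ₂L, h3, hζ₂0]
    · simp only [hζdef, if_neg h0, add_sub_cancel_left, hζ₂L]
  -- At a jump time one of the halves is nontrivial, and its cost is at least its positive
  -- `Ψ₀`-size.
  have hpos : 0 < L₁ + L₂ := by
    have hl0 := ENNReal.toReal_mono hl (S.ofReal_Ψ₀_le_cost t (S.left u t) (u t))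
    have hr0 := ENNReal.toReal_mono hr (S.ofReal_Ψ₀_le_cost t (u t) (S.right u t))
    rw [ENNReal.toReal_ofReal (S.Ψ₀_nonneg _)] at hl0 hr0
    rcases hJ.2 with hne | hne
    · linarith [S.Ψ₀_pos _ (sub_ne_zero.2 hne.symm)]
    · linarith [S.Ψ₀_pos _ (sub_ne_zero.2 hne.symm)]
  have hE : S.E t (S.left u t) - S.E t (S.right u t) = L₁ + L₂ := by linarith
  have hcost : S.cost t (ζ 0) (ζ (L₁ + L₂)) = ENNReal.ofReal (L₁ + L₂) := by
    rw [hζ0, hζL, ← hE, hlrE, ENNReal.ofReal_toReal hlr]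
  have hopt := hζ.isOptimalTransition ht hpos hcost (by rw [hζ0, hζL, hE])
  have hK := hζ.mem_Kstar ht hpos (by
    rw [hζ0, hζL]
    linarith [hS.left hu ht (S.right u t)])
  rw [hζ0, hζL] at hopt
  refine ⟨_, _, _, hopt, fun r hr => ?_, (L₁ : EReal), ⟨?_, ?_⟩, by simpa using hζm⟩
  · have hbot : r ≠ ⊥ := fun h => absurd (h ▸ hr.1) (not_le.2 (EReal.bot_lt_coe _))
    have htop : r ≠ ⊤ := fun h => absurd (h ▸ hr.2) (not_le.2 (EReal.coe_lt_top _))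
    lift r to ℝ using ⟨htop, hbot⟩
    exact hK r ⟨EReal.coe_le_coe_iff.1 hr.1, EReal.coe_le_coe_iff.1 hr.2⟩
  · exact EReal.coe_le_coe_iff.2 h1
  · exact EReal.coe_le_coe_iff.2 (by linarith)

/-- The cost splits at `u(t)`, and the total is the released energy, which by (E) is the sum of the
two `Ψ₀`-sizes. These bound the half costs from below, so equality holds in both halves. -/
theorem EnergyBalance.jumpsEnergetic (h : S.EnergyBalance u) (hu : S.IsBV u)
    (hT : ∀ t ∈ S.jumpSet u, ∃ (r₀ r₁ : EReal) (ϑ : EReal → X),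
      S.IsOptimalTransition t (S.left u t) (S.right u t) r₀ r₁ ϑ ∧
        ∃ r ∈ Icc r₀ r₁, ϑ r = u t) : S.JumpsEnergetic u := by
  intro t hJ
  obtain ⟨r₀, r₁, ϑ, hϑ, r, hr, hru⟩ := hT t hJ
  refine ENNReal.eq_and_eq_of_add_le (S.ofReal_Ψ₀_le_cost t _ _) (S.ofReal_Ψ₀_le_cost t _ _) ?_
    ENNReal.ofReal_ne_top ENNReal.ofReal_ne_top
  have h1 := hϑ.cost_add_cost_le hJ.1 hr
  rw [hru] at h1
  refine h1.trans (le_of_eq ?_)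
  obtain ⟨h2, h3⟩ := EReal.coe_eq_coe_ennreal_iff.1 hϑ.energy_eq
  rw [leftΨ₀, rightΨ₀, ← ENNReal.ofReal_add (S.Ψ₀_nonneg _) (S.Ψ₀_nonneg _),
    ← h.left hu hJ.1, ← h.right hu hJ.1, sub_add_sub_cancel, h3, ENNReal.ofReal_toReal h2]

end RISystem

/-! ### The theorem. -/

theorem corollary4p8 {X : Type*} [NormedAddCommGroup X] [NormedSpace ℝ X] [FiniteDimensional ℝ X]
    (S : RISystem X) (u : ℝ → X) :
    -- (1) the energy balance of BV solutions
    (S.IsBVSolution u →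
      ((S.EnergyBalance u ↔
          ∀ t ∈ S.jumpSet u, S.TransitionsEnergetic t (S.left u t) (u t) ∧
            S.TransitionsEnergetic t (u t) (S.right u t)) ∧
        ((∀ t ∈ S.jumpSet u, S.TransitionsEnergetic t (S.left u t) (S.right u t)) →
          S.EnergyBalance u) ∧
        ((∀ t ∈ S.jumpSet u, u t = S.left u t ∨ u t = S.right u t) →
          (S.EnergyBalance u ↔
            ∀ t ∈ S.jumpSet u, S.TransitionsEnergetic t (S.left u t) (S.right u t))))) ∧
    -- (2) BV solutions that are energetic
    (S.IsBVSolution u →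
      ((S.IsEnergeticSolution u ↔ S.GloballyStable u) ∧
        (S.IsEnergeticSolution u →
          ∀ t ∈ S.jumpSet u, S.TransitionsEnergetic t (S.left u t) (u t) ∧
            S.TransitionsEnergetic t (u t) (S.right u t) ∧
            S.TransitionsEnergetic t (S.left u t) (S.right u t)))) ∧
    -- (3) energetic solutions that are BV solutions
    (S.IsEnergeticSolution u →
      (S.IsBVSolution u ↔
        ∀ t ∈ S.jumpSet u, ∃ (r₀ r₁ : EReal) (ϑ : EReal → X),
          S.IsOptimalTransition t (S.left u t) (S.right u t) r₀ r₁ ϑ ∧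
          S.IsSliding t r₀ r₁ ϑ ∧ ∃ r ∈ Icc r₀ r₁, ϑ r = u t)) := by
  refine ⟨?_, ?_, ?_⟩
  · rintro ⟨hu, -, hP⟩
    have h1 := hP.energyBalance_iff.trans hP.jumpsEnergetic_iff
    have h2 : (∀ t ∈ S.jumpSet u, S.TransitionsEnergetic t (S.left u t) (S.right u t)) →
        S.EnergyBalance u := fun hT =>
      hP.energyBalance_iff.2 (hP.jumpsEnergetic_of_transitionsEnergetic hT)
    refine ⟨h1, h2, fun h3 => ⟨fun hE t hJ => ?_, h2⟩⟩
    obtain ⟨hl, hr⟩ := h1.1 hE t hJ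
    -- When `u(t)` is a one-sided limit, one half of the jump is trivial and the other is the whole
    -- jump.
    rcases h3 t hJ with h | h
    · rwa [h] at hr
    · rwa [h] at hl
  · rintro ⟨hu, -, hP⟩
    refine ⟨⟨fun h => h.2.1, fun hS => ⟨hu, hS, hP.energyBalance_iff.2 (hP.jumpsEnergetic hS)⟩⟩, ?_⟩
    rintro ⟨-, hS, -⟩ t hJ
    obtain ⟨hl, hr⟩ := hP.jumpsEnergetic_iff.1 (hP.jumpsEnergetic hS) t hJ
    exact ⟨hl, hr, (RISystem.transitionsEnergetic_iff hJ.1 (hP.left_right hJ.1)).2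
      (RISystem.cost_eq_of_energy_le (hP.left_right hJ.1) (hS.left hu hJ.1 _))⟩
  · rintro ⟨hu, hS, hE⟩
    refine ⟨?_, fun hT => ⟨hu, ?_, ?_⟩⟩
    · rintro ⟨_, -, hP⟩ t hJ
      exact hP.exists_isSliding hS hJ
    · exact Eventually.of_forall fun t ht => hS.neg_DE_mem_Kstar ht.1
    · refine ((hE.jumpsEnergetic hu fun t hJ => ?_).energyBalance_iff_pEnergyBalance hu).1 hE
      obtain ⟨r₀, r₁, ϑ, hϑ, -, h⟩ := hT t hJ
      exact ⟨r₀, r₁, ϑ, hϑ, h⟩
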